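/- Let $\rho>0$, let $M=\mathbb{S}^1\times[-\rho,\rho]$ with coordinates $(\theta,\sigma)$, $\theta$ being $2\pi$-periodic, and let \[ g_0=d\sigma^2+f(\sigma)^2\,d\theta^2, \] with $f$ smooth and positive on $[-\rho,\rho]$. Assume that $g_0$ is symmetric by reflection with respect to the middle parallel $\mathbb{S}^1\times\{0\}$ (that is, $f(-\sigma)=f(\sigma)$), that its scalar curvature satisfies $R_{g_0}\ge 0$, and that $R_{g_0}$ is decreasing (in the weak sense) as one moves from the middle parallel towards either of the boundary components. Consider the Ricci flow on $M$ with prescribed geodesic curvature, \[ \frac{\partial\tilde g}{\partial\tilde t}=-\tilde R\,\tilde g\ \text{ in } M\times(0,\tilde T),\qquad k_{\tilde g}=k_{g_0}\ \text{ on }\partial M\times(0,\tilde T),\qquad \tilde g=g_0\ \text{ at }\tilde t=0, \] where $0<\tilde T\le\infty$, $\tilde R$ is the scalar curvature of $\tilde g$ and $k$ the geodesic curvature of $\partial M$ (the solution is a family of Riemannian metrics on $M$, smooth up to $\partial M$ for $\tilde t>0$ and continuous up to $\tilde t=0$ together with its space derivatives of order at most two; it is not assumed to have any symmetry). The normalised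 flow is obtained from it by rescaling to area one, $g=\phi\,\tilde g$ with $\phi(\tilde t)>0$ such that $A_g(M)=1$, and by passing to the new time $t=\int_0^{\tilde t}\phi(\tau)\,d\tau$, which then ranges over an interval $[0,T)$, $0<T\le\infty$. Then the scalar curvature remains uniformly bounded in the normalised flow: there is a constant $C$, depending only on $g_0$, such that for every such flow, on whatever time interval $[0,T)$, $0<T\le\infty$, it is defined, \[ |R_{g(t)}(p)|\le C\qquad\text{for all } p\in M \text{ and all } t\in[0,T). \] -/

import Mathlib

open scoped ContDiff

namespace CylinderRicciFlow

/-- The closed strip `ℝ × [-ρ, ρ]`, the universal cover of the cylinder `M = S¹ × [-ρ, ρ]`, with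
coordinates `p = (θ, σ)`. Tensor fields on `M` are tensor fields on the strip that are `2π`-periodic
in `θ`; the coordinate index `0` stands for `θ` and the index `1` for `σ`. -/
def strip (ρ : ℝ) : Set (ℝ × ℝ) := {p | p.2 ∈ Set.Icc (-ρ) ρ}

/-- The (universal cover of the) boundary `∂M = S¹ × {-ρ, ρ}`. -/
def bdry (ρ : ℝ) : Set (ℝ × ℝ) := {p | p.2 = -ρ ∨ p.2 = ρ}

/-- A field of `2 × 2` matrices, the components of a covariant 2-tensor in the coordinates
`(θ, σ)`. Only the values on the strip matter. -/
abbrev TensorField := ℝ × ℝ → Matrix (Fin 2) (Fin 2) ℝ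

/-- `g` is a smooth (up to the boundary) Riemannian metric on `M = S¹ × [-ρ, ρ]`. -/
structure IsRiemannianMetric (ρ : ℝ) (g : TensorField) : Prop where
  smooth : ∀ a b, ContDiffOn ℝ ∞ (fun p => g p a b) (strip ρ)
  periodic : ∀ p ∈ strip ρ, g (p.1 + 2 * Real.pi, p.2) = g p
  posDef : ∀ p ∈ strip ρ, (g p).PosDef

/-- The partial derivative in the `i`-th coordinate (one-sided in `σ` at the boundary). -/
noncomputable def pd (ρ : ℝ) (i : Fin 2) (h : ℝ × ℝ → ℝ) (p : ℝ × ℝ) : ℝ :=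
  if i = 0 then deriv (fun x => h (x, p.2)) p.1
  else derivWithin (fun y => h (p.1, y)) (Set.Icc (-ρ) ρ) p.2

/-- The Christoffel symbol `Γᵏᵢⱼ` of `g`. -/
noncomputable def christoffel (ρ : ℝ) (g : TensorField) (k i j : Fin 2) (p : ℝ × ℝ) : ℝ :=
  (1 / 2) * ∑ l, (g p)⁻¹ k l *
    (pd ρ i (fun q => g q j l) p + pd ρ j (fun q => g q i l) p - pd ρ l (fun q => g q i j) p)

/-- The Ricci curvature `Ric_{jk} = ∂ᵢΓⁱⱼₖ - ∂ⱼΓⁱᵢₖ + ΓⁱᵢₘΓᵐⱼₖ - ΓⁱⱼₘΓᵐᵢₖ` of `g`. -/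
noncomputable def ricci (ρ : ℝ) (g : TensorField) (j k : Fin 2) (p : ℝ × ℝ) : ℝ :=
  ∑ i, (pd ρ i (christoffel ρ g i j k) p - pd ρ j (christoffel ρ g i i k) p
    + ∑ m, (christoffel ρ g i i m p * christoffel ρ g m j k p
        - christoffel ρ g i j m p * christoffel ρ g m i k p))

/-- The scalar curvature `R = gʲᵏ Ric_{jk}` (twice the Gauss curvature). -/
noncomputable def scalarCurv (ρ : ℝ) (g : TensorField) (p : ℝ × ℝ) : ℝ :=
  ∑ j, ∑ k, (g p)⁻¹ j k * ricci ρ g j k p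

/-- The geodesic curvature of `∂M` at a boundary point `p`, with the sign for which the boundary of
a flat disc has positive curvature: `k = -⟨∇_T T, η⟩`, with `T` the unit tangent `∂_θ / |∂_θ|` and
`η` the outward unit normal. As `η` is dual to the covector `± dσ / |dσ|`, with `±` the sign of
`σ`, and `|dσ|² = g^{σσ}`, this is `∓ Γ^σ_{θθ} / (g_{θθ} √g^{σσ})`. -/
noncomputable def geodesicCurv (ρ : ℝ) (g : TensorField) (p : ℝ × ℝ) : ℝ :=
  -(Real.sign p.2 * christoffel ρ g 1 0 0 p) / (g p 0 0 * Real.sqrt ((g p)⁻¹ 1 1))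

/-- The area of `M`. -/
noncomputable def area (ρ : ℝ) (g : TensorField) : ℝ :=
  ∫ θ in (0 : ℝ)..(2 * Real.pi), ∫ σ in (-ρ)..ρ, Real.sqrt (g (θ, σ)).det

/-- The space-time `[0, T) × M`, with `T ≤ ∞`. -/
def spaceTime (ρ : ℝ) (T : EReal) : Set (ℝ × (ℝ × ℝ)) :=
  {q | 0 ≤ q.1 ∧ (q.1 : EReal) < T ∧ q.2 ∈ strip ρ}

/-- `g` is a (classical) solution on `[0, T)`, `0 < T ≤ ∞`, of the unnormalised Ricci flow
`∂g/∂t = -R g` in `M × (0, T)`, `k_g = k_{g₀}` on `∂M × (0, T)`, `g = g₀` at `t = 0`.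

The solution is smooth up to the boundary for positive times; at time zero it is required to be
continuous together with its space derivatives of order at most two, which is what the boundary
value problem provides without further compatibility conditions on `g₀` at `∂M`. -/
structure IsRicciFlow (ρ : ℝ) (g₀ : TensorField) (T : EReal) (g : ℝ → TensorField) : Prop where
  pos : 0 < T
  metric : ∀ t : ℝ, 0 ≤ t → (t : EReal) < T → IsRiemannianMetric ρ (g t)
  smooth : ∀ a b, ContDiffOn ℝ ∞ (fun q : ℝ × (ℝ × ℝ) => g q.1 q.2 a b)
    {q | 0 < q.1 ∧ (q.1 : EReal) < T ∧ q.2 ∈ strip ρ}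
  cont : ∀ a b, ContinuousOn (fun q : ℝ × (ℝ × ℝ) => g q.1 q.2 a b) (spaceTime ρ T)
  cont_one : ∀ a b i, ContinuousOn
    (fun q : ℝ × (ℝ × ℝ) => pd ρ i (fun p => g q.1 p a b) q.2) (spaceTime ρ T)
  cont_two : ∀ a b i j, ContinuousOn
    (fun q : ℝ × (ℝ × ℝ) => pd ρ i (pd ρ j (fun p => g q.1 p a b)) q.2) (spaceTime ρ T)
  evolution : ∀ t : ℝ, 0 < t → (t : EReal) < T → ∀ p ∈ strip ρ, ∀ a b,
    HasDerivAt (fun s => g s p a b) (-scalarCurv ρ (g t) p * g t p a b) t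
  boundary : ∀ t : ℝ, 0 < t → (t : EReal) < T → ∀ p ∈ bdry ρ,
    geodesicCurv ρ (g t) p = geodesicCurv ρ g₀ p
  initial : ∀ p ∈ strip ρ, g 0 p = g₀ p

/-- `g`, defined on the time interval `[0, T)`, `0 < T ≤ ∞`, is a normalised Ricci flow with
initial data `g₀`: it is obtained from a solution `g'` of the unnormalised flow on some `[0, T')`
by rescaling to area one, `g = φ g'`, and passing to the new time `t(t') = ∫₀^{t'} φ`. -/
def IsNormalisedRicciFlow (ρ : ℝ) (g₀ : TensorField) (T : EReal) (g : ℝ → TensorField) : Prop :=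
  ∃ (T' : EReal) (g' : ℝ → TensorField) (φ : ℝ → ℝ),
    IsRicciFlow ρ g₀ T' g' ∧
    (∀ s : ℝ, 0 ≤ s → (s : EReal) < T' →
      0 < φ s ∧ area ρ (fun p => φ s • g' s p) = 1) ∧
    (∀ t : ℝ, (0 ≤ t ∧ (t : EReal) < T) ↔
      ∃ s : ℝ, 0 ≤ s ∧ (s : EReal) < T' ∧ t = ∫ x in (0 : ℝ)..s, φ x) ∧
    (∀ s : ℝ, 0 ≤ s → (s : EReal) < T' → ∀ p ∈ strip ρ,
      g (∫ x in (0 : ℝ)..s, φ x) p = φ s • g' s p)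

/-- The metric `dσ² + f(σ)² dθ²`. -/
def warpedMetric (f : ℝ → ℝ) : TensorField := fun p => !![f p.2 ^ 2, 0; 0, 1]

/-- The scalar curvature of `g` is decreasing from the middle: it does not increase when one moves
from the middle parallel `S¹ × {0}` towards any of the two boundary components. -/
def DecreasingFromMiddle (ρ : ℝ) (g : TensorField) : Prop :=
  ∀ θ : ℝ, AntitoneOn (fun σ => scalarCurv ρ g (θ, σ)) (Set.Icc 0 ρ) ∧
    MonotoneOn (fun σ => scalarCurv ρ g (θ, σ)) (Set.Icc (-ρ) 0)

end CylinderRicciFlow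

/-! Write `D = f ∂_σ`. The initial metric is `f²(dθ² + dσ²/f²)`, a conformal multiple of a flat
cylinder metric with Laplacian `Δ = ∂_θ² + D²`. All components of the metric evolve by the same
factor `-R`, so the flow stays in this conformal class: `g = e^{2W}(dθ² + dσ²/f²)`, where `W = log
f` at time zero, `W_t = e^{-2W} ΔW = -R/2`, and `D W = c e^W` on the boundary, with `c = f'/f`.
Nonnegative curvature makes `f` concave; as `f` is even, `c ≤ 0` at `ρ` and `c ≥ 0` at `-ρ`.

For these signs the linearised problem obeys a maximum principle (`parabolic_nonpos`,
`linearised_nonpos`). Applied to `±W_θ` it shows that the flow is rotationally symmetric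
(`pd_angle_eq_zero`); applied to `W_t` it shows that `ΔW ≤ 0`, so `R ≥ 0` (`flatLaplacian_nonpos`).

The decisive quantity is `Z = (DW)² - DDW`. In terms of the radius `r = e^W` of the parallels as a
function of arclength, it is `r'² - r r''`. It satisfies `Z_t = e^{-2W} DDZ - 4 e^{-2W} DW DZ`,
without zeroth order term, and `DZ = -e^{2W} D(W_t)` (`gradient_quantity_equations`). The boundary
condition and `W_t ≤ 0` make the outward derivative of `Z` nonpositive, so `Z ≤ M` with `M` a bound
at time zero (`gradient_quantity_le`).

Both terms of `Z` are nonnegative, so `|DW| ≤ √M` and `-ΔW ≤ M`, and these bounds are unchanged when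
a constant is added to `W`, that is, under rescaling of the metric. The first bounds the oscillation
of `W`; with unit area this bounds `e^{-2W}`, and then the second bounds `R = -2 e^{-2W} ΔW`
(`abs_scalarCurv_le_of_area_eq_one`). Only the data at time zero enter, so the constant does not
depend on the flow or on its lifetime. -/

namespace CylinderRicciFlow

/-! ### Calculus of directional derivatives within a set. -/

section DirectionalDerivative

variable {E : Type*} [NormedAddCommGroup E] [NormedSpace ℝ E]

/-- The derivative of `H` at `q` within `S` in the direction `e`. -/
noncomputable def dirDeriv (S : Set E) (e : E) (H : E → ℝ) (q : E) : ℝ := fderivWithin ℝ H S q e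

variable {S : Set E} {e e' q : E} {H K : E → ℝ}

theorem contDiffOn_dirDeriv (hS : UniqueDiffOn ℝ S) (hH : ContDiffOn ℝ ∞ H S) (e : E) :
    ContDiffOn ℝ ∞ (dirDeriv S e H) S :=
  (hH.fderivWithin hS (by simp)).clm_apply contDiffOn_const

theorem differentiableWithinAt_of_contDiffOn (hH : ContDiffOn ℝ ∞ H S) (hq : q ∈ S) :
    DifferentiableWithinAt ℝ H S q :=
  hH.differentiableOn (by simp) q hq

theorem dirDeriv_congr (h : Set.EqOn H K S) (hq : q ∈ S) : dirDeriv S e H q = dirDeriv S e K q := by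
  unfold dirDeriv
  rw [fderivWithin_congr h (h hq)]

theorem dirDeriv_mul (hS : UniqueDiffOn ℝ S) (hH : ContDiffOn ℝ ∞ H S) (hK : ContDiffOn ℝ ∞ K S)
    (hq : q ∈ S) :
    dirDeriv S e (fun x => H x * K x) q = dirDeriv S e H q * K q + H q * dirDeriv S e K q := by
  unfold dirDeriv
  rw [fderivWithin_fun_mul (hS q hq) (differentiableWithinAt_of_contDiffOn hH hq)
    (differentiableWithinAt_of_contDiffOn hK hq)]
  simp
  ring

theorem dirDeriv_add (hS : UniqueDiffOn ℝ S) (hH : ContDiffOn ℝ ∞ H S) (hK : ContDiffOn ℝ ∞ K S)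
    (hq : q ∈ S) :
    dirDeriv S e (fun x => H x + K x) q = dirDeriv S e H q + dirDeriv S e K q := by
  unfold dirDeriv
  rw [fderivWithin_fun_add (hS q hq) (differentiableWithinAt_of_contDiffOn hH hq)
    (differentiableWithinAt_of_contDiffOn hK hq)]
  simp

theorem dirDeriv_sub (hS : UniqueDiffOn ℝ S) (hH : ContDiffOn ℝ ∞ H S) (hK : ContDiffOn ℝ ∞ K S)
    (hq : q ∈ S) :
    dirDeriv S e (fun x => H x - K x) q = dirDeriv S e H q - dirDeriv S e K q := by
  unfold dirDeriv
  rw [fderivWithin_fun_sub (hS q hq) (differentiableWithinAt_of_contDiffOn hH hq)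
    (differentiableWithinAt_of_contDiffOn hK hq)]
  simp

theorem dirDeriv_const (c : ℝ) : dirDeriv S e (fun _ => c) q = 0 := by
  simp [dirDeriv]

theorem dirDeriv_const_mul (hS : UniqueDiffOn ℝ S) (hH : ContDiffOn ℝ ∞ H S) (c : ℝ)
    (hq : q ∈ S) : dirDeriv S e (fun x => c * H x) q = c * dirDeriv S e H q := by
  rw [dirDeriv_mul hS contDiffOn_const hH hq, dirDeriv_const]
  ring

theorem dirDeriv_exp (hS : UniqueDiffOn ℝ S) (hH : ContDiffOn ℝ ∞ H S) (hq : q ∈ S) :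
    dirDeriv S e (fun x => Real.exp (H x)) q = Real.exp (H q) * dirDeriv S e H q := by
  unfold dirDeriv
  rw [fderivWithin_exp (differentiableWithinAt_of_contDiffOn hH hq) (hS q hq)]
  simp

/-- Symmetry of the second derivative within `S` holds at boundary points too, as limits from the
interior; this is the role of `hS'`. -/
theorem dirDeriv_comm (hS : UniqueDiffOn ℝ S) (hS' : S ⊆ closure (interior S))
    (hH : ContDiffOn ℝ ∞ H S) (hq : q ∈ S) :
    dirDeriv S e (dirDeriv S e' H) q = dirDeriv S e' (dirDeriv S e H) q := by
  have key : ∀ a b : E, dirDeriv S a (dirDeriv S b H) q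
      = fderivWithin ℝ (fderivWithin ℝ H S) S q a b := by
    intro a b
    have hd : DifferentiableWithinAt ℝ (fderivWithin ℝ H S) S q :=
      (hH.fderivWithin (m := ∞) hS (by simp)).differentiableOn (by simp) q hq
    change fderivWithin ℝ (fun x => fderivWithin ℝ H S x b) S q a = _
    rw [fderivWithin_clm_apply (hS q hq) hd (differentiableWithinAt_const b)]
    simp
  rw [key, key]
  have h2 : minSmoothness ℝ 2 ≤ ∞ := by
    rw [minSmoothness_of_isRCLikeNormedField]
    exact WithTop.coe_le_coe.2 le_top
  exact (hH q hq).isSymmSndFDerivWithinAt h2 hS (hS' hq) hq e e'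

theorem hasDerivWithinAt_dirDeriv {γ : ℝ → E} {u : Set ℝ} {s : ℝ} (hH : ContDiffOn ℝ ∞ H S)
    (hγ : HasDerivWithinAt γ e u s) (hu : Set.MapsTo γ u S) (hs : γ s ∈ S) :
    HasDerivWithinAt (fun x => H (γ x)) (dirDeriv S e H (γ s)) u s :=
  (differentiableWithinAt_of_contDiffOn hH hs).hasFDerivWithinAt.comp_hasDerivWithinAt s hγ hu

end DirectionalDerivative

/-! ### Partial derivatives on the strip. -/

section Strip

variable {ρ : ℝ}

theorem strip_eq_prod (ρ : ℝ) : strip ρ = Set.univ ×ˢ Set.Icc (-ρ) ρ := by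
  ext p; simp [strip]

theorem uniqueDiffOn_strip (hρ : 0 < ρ) : UniqueDiffOn ℝ (strip ρ) := by
  rw [strip_eq_prod]
  exact uniqueDiffOn_univ.prod (uniqueDiffOn_Icc (by linarith))

/-- The coordinate vector fields on the strip. -/
def stripVec (i : Fin 2) : ℝ × ℝ := if i = 0 then (1, 0) else (0, 1)

theorem hasDerivAt_dirDeriv_strip {h : ℝ × ℝ → ℝ} (hh : ContDiffOn ℝ ∞ h (strip ρ)) {p : ℝ × ℝ}
    (hp : p ∈ strip ρ) :
    HasDerivAt (fun x => h (x, p.2)) (dirDeriv (strip ρ) (stripVec 0) h p) p.1 := by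
  rw [← hasDerivWithinAt_univ]
  refine hasDerivWithinAt_dirDeriv (γ := fun x => (x, p.2)) hh ?_ (fun x _ => hp) hp
  exact (hasDerivWithinAt_id _ _).prodMk (hasDerivWithinAt_const _ _ _)

theorem hasDerivWithinAt_dirDeriv_strip {h : ℝ × ℝ → ℝ} (hh : ContDiffOn ℝ ∞ h (strip ρ))
    {p : ℝ × ℝ} (hp : p ∈ strip ρ) :
    HasDerivWithinAt (fun y => h (p.1, y)) (dirDeriv (strip ρ) (stripVec 1) h p)
      (Set.Icc (-ρ) ρ) p.2 := by
  refine hasDerivWithinAt_dirDeriv (γ := fun y => (p.1, y)) hh ?_ (fun x hx => hx) hp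
  exact (hasDerivWithinAt_const _ _ _).prodMk (hasDerivWithinAt_id _ _)

theorem pd_eq_dirDeriv (hρ : 0 < ρ) {h : ℝ × ℝ → ℝ} (hh : ContDiffOn ℝ ∞ h (strip ρ)) (i : Fin 2)
    {p : ℝ × ℝ} (hp : p ∈ strip ρ) : pd ρ i h p = dirDeriv (strip ρ) (stripVec i) h p := by
  fin_cases i
  · exact (hasDerivAt_dirDeriv_strip hh hp).deriv
  · exact (hasDerivWithinAt_dirDeriv_strip hh hp).derivWithin (uniqueDiffOn_Icc (by linarith) _ hp)

theorem contDiffOn_pd (hρ : 0 < ρ) {h : ℝ × ℝ → ℝ} (hh : ContDiffOn ℝ ∞ h (strip ρ)) (i : Fin 2) :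
    ContDiffOn ℝ ∞ (pd ρ i h) (strip ρ) :=
  (contDiffOn_dirDeriv (uniqueDiffOn_strip hρ) hh (stripVec i)).congr
    fun _ hp => pd_eq_dirDeriv hρ hh i hp

theorem pd_congr {h k : ℝ × ℝ → ℝ} (H : Set.EqOn h k (strip ρ)) (i : Fin 2) {p : ℝ × ℝ}
    (hp : p ∈ strip ρ) : pd ρ i h p = pd ρ i k p := by
  unfold pd
  split_ifs
  · congr 1
    funext x
    exact H hp
  · exact derivWithin_congr (fun y hy => H hy) (H hp)

theorem pd_periodic {h : ℝ × ℝ → ℝ} {c : ℝ} (H : ∀ p ∈ strip ρ, h (p.1 + c, p.2) = h p) (i : Fin 2)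
    {p : ℝ × ℝ} (hp : p ∈ strip ρ) : pd ρ i h (p.1 + c, p.2) = pd ρ i h p := by
  unfold pd
  split_ifs
  · simp only
    rw [← deriv_comp_add_const (fun x => h (x, p.2)) c p.1]
    congr 1
    funext x
    exact H (x, p.2) hp
  · exact derivWithin_congr (fun y hy => H (p.1, y) hy) (H p hp)

variable {h k : ℝ × ℝ → ℝ} {i : Fin 2} {p : ℝ × ℝ}

theorem pd_mul (hρ : 0 < ρ) (hh : ContDiffOn ℝ ∞ h (strip ρ)) (hk : ContDiffOn ℝ ∞ k (strip ρ))
    (hp : p ∈ strip ρ) :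
    pd ρ i (fun x => h x * k x) p = pd ρ i h p * k p + h p * pd ρ i k p := by
  rw [pd_eq_dirDeriv hρ hh i hp, pd_eq_dirDeriv hρ hk i hp, pd_eq_dirDeriv hρ (hh.mul hk) i hp,
    dirDeriv_mul (uniqueDiffOn_strip hρ) hh hk hp]

theorem pd_exp (hρ : 0 < ρ) (hh : ContDiffOn ℝ ∞ h (strip ρ)) (hp : p ∈ strip ρ) :
    pd ρ i (fun x => Real.exp (h x)) p = Real.exp (h p) * pd ρ i h p := by
  rw [pd_eq_dirDeriv hρ hh i hp, pd_eq_dirDeriv hρ hh.exp i hp,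
    dirDeriv_exp (uniqueDiffOn_strip hρ) hh hp]

theorem pd_const (c : ℝ) : pd ρ i (fun _ => c) p = 0 := by
  unfold pd
  split_ifs <;> simp

theorem pd_const_mul (hρ : 0 < ρ) (hh : ContDiffOn ℝ ∞ h (strip ρ)) (c : ℝ) (hp : p ∈ strip ρ) :
    pd ρ i (fun x => c * h x) p = c * pd ρ i h p := by
  rw [pd_mul hρ contDiffOn_const hh hp, pd_const]
  ring

theorem pd_zero_of_snd (u : ℝ → ℝ) : pd ρ 0 (fun x => u x.2) p = 0 := by
  simp [pd]

theorem pd_one_of_snd (u : ℝ → ℝ) :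
    pd ρ 1 (fun x => u x.2) p = derivWithin u (Set.Icc (-ρ) ρ) p.2 := by
  simp [pd]

theorem contDiffOn_comp_snd {u : ℝ → ℝ} (hu : ContDiffOn ℝ ∞ u (Set.Icc (-ρ) ρ)) :
    ContDiffOn ℝ ∞ (fun x : ℝ × ℝ => u x.2) (strip ρ) :=
  hu.comp contDiff_snd.contDiffOn fun _ hx => hx

end Strip

/-! ### Curvature of metrics conformal to the flat cylinder. -/

section ConformalMetric

/-- On the strip, `g = e^{2w} (dθ² + dσ² / f²)`. -/
def HasConformalFactor (ρ : ℝ) (f : ℝ → ℝ) (g : TensorField) (w : ℝ × ℝ → ℝ) : Prop :=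
  ∀ p ∈ strip ρ, g p = !![Real.exp (2 * w p), 0; 0, Real.exp (2 * w p) / f p.2 ^ 2]

/-- The Laplacian of the flat metric `dθ² + dσ² / f²`. -/
noncomputable def flatLaplacian (ρ : ℝ) (f : ℝ → ℝ) (w : ℝ × ℝ → ℝ) (p : ℝ × ℝ) : ℝ :=
  pd ρ 0 (pd ρ 0 w) p
    + f p.2 * (derivWithin f (Set.Icc (-ρ) ρ) p.2 * pd ρ 1 w p + f p.2 * pd ρ 1 (pd ρ 1 w) p)

variable {ρ : ℝ} {f : ℝ → ℝ} {g : TensorField} {w : ℝ × ℝ → ℝ}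

theorem HasConformalFactor.inv_eq (hf_pos : ∀ σ ∈ Set.Icc (-ρ) ρ, 0 < f σ)
    (hg : HasConformalFactor ρ f g w) {p : ℝ × ℝ} (hp : p ∈ strip ρ) :
    (g p)⁻¹ = !![Real.exp (-(2 * w p)), 0; 0, f p.2 ^ 2 * Real.exp (-(2 * w p))] := by
  have hf := (hf_pos p.2 hp).ne'
  have he := (Real.exp_pos (2 * w p)).ne'
  apply Matrix.inv_eq_right_inv
  rw [hg p hp, Real.exp_neg, Matrix.mul_fin_two, Matrix.one_fin_two]
  congr! 4 <;> field_simp <;> simp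

theorem HasConformalFactor.pd_zero_zero (hρ : 0 < ρ) (hw : ContDiffOn ℝ ∞ w (strip ρ))
    (hg : HasConformalFactor ρ f g w) (i : Fin 2) {p : ℝ × ℝ} (hp : p ∈ strip ρ) :
    pd ρ i (fun q => g q 0 0) p = 2 * Real.exp (2 * w p) * pd ρ i w p := by
  have h : Set.EqOn (fun q => g q 0 0) (fun q => Real.exp (2 * w q)) (strip ρ) := by
    intro q hq; simp [hg q hq]
  rw [pd_congr h i hp, pd_exp hρ (contDiffOn_const.mul hw) hp, pd_const_mul hρ hw _ hp]
  ring

theorem HasConformalFactor.pd_one_one (hρ : 0 < ρ) (hf : ContDiffOn ℝ ∞ f (Set.Icc (-ρ) ρ))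
    (hf_pos : ∀ σ ∈ Set.Icc (-ρ) ρ, 0 < f σ) (hw : ContDiffOn ℝ ∞ w (strip ρ))
    (hg : HasConformalFactor ρ f g w) (i : Fin 2) {p : ℝ × ℝ} (hp : p ∈ strip ρ) :
    pd ρ i (fun q => g q 1 1) p = Real.exp (2 * w p) / f p.2 ^ 2 *
      (2 * pd ρ i w p - 2 * pd ρ i (fun q => f q.2) p / f p.2) := by
  have hF := contDiffOn_comp_snd hf
  have hFp := (hf_pos p.2 hp).ne'
  have hg1 : ContDiffOn ℝ ∞ (fun q => g q 1 1) (strip ρ) :=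
    (((contDiffOn_const (c := (2 : ℝ))).mul hw).exp.div (hF.pow 2) fun q hq => pow_ne_zero 2 (hf_pos q.2 hq).ne').congr
      fun q hq => by simp [hg q hq]
  -- With the denominator cleared, the product rule suffices and the identity is solved for the
  -- derivative of `g₁₁`.
  have h : Set.EqOn (fun q => (g q 1 1 * f q.2) * f q.2) (fun q => Real.exp (2 * w q))
      (strip ρ) := by
    intro q hq
    have := (hf_pos q.2 hq).ne'
    simp [hg q hq]
    field_simp
  have key := pd_congr h i hp
  rw [pd_exp hρ (contDiffOn_const.mul hw) hp, pd_const_mul hρ hw _ hp,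
    pd_mul hρ (hg1.mul hF) hF hp, pd_mul hρ hg1 hF hp] at key
  have hgp : g p 1 1 = Real.exp (2 * w p) / f p.2 ^ 2 := by simp [hg p hp]
  rw [hgp] at key
  field_simp at key ⊢
  linear_combination key

theorem HasConformalFactor.pd_off_diag (hg : HasConformalFactor ρ f g w) (i : Fin 2) {p : ℝ × ℝ}
    (hp : p ∈ strip ρ) :
    pd ρ i (fun q => g q 0 1) p = 0 ∧ pd ρ i (fun q => g q 1 0) p = 0 := by
  constructor
  · rw [pd_congr (k := fun _ => 0) (fun q hq => by simp [hg q hq]) i hp, pd_const]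
  · rw [pd_congr (k := fun _ => 0) (fun q hq => by simp [hg q hq]) i hp, pd_const]

theorem HasConformalFactor.christoffel_eq (hρ : 0 < ρ) (hf : ContDiffOn ℝ ∞ f (Set.Icc (-ρ) ρ))
    (hf_pos : ∀ σ ∈ Set.Icc (-ρ) ρ, 0 < f σ) (hw : ContDiffOn ℝ ∞ w (strip ρ))
    (hg : HasConformalFactor ρ f g w) {p : ℝ × ℝ} (hp : p ∈ strip ρ) :
    christoffel ρ g 0 0 0 p = pd ρ 0 w p ∧
    christoffel ρ g 0 0 1 p = pd ρ 1 w p ∧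
    christoffel ρ g 0 1 0 p = pd ρ 1 w p ∧
    christoffel ρ g 0 1 1 p = -pd ρ 0 w p / f p.2 ^ 2 ∧
    christoffel ρ g 1 0 0 p = -f p.2 ^ 2 * pd ρ 1 w p ∧
    christoffel ρ g 1 0 1 p = pd ρ 0 w p ∧
    christoffel ρ g 1 1 0 p = pd ρ 0 w p ∧
    christoffel ρ g 1 1 1 p
      = pd ρ 1 w p - derivWithin f (Set.Icc (-ρ) ρ) p.2 / f p.2 := by
  have hFp := (hf_pos p.2 hp).ne'
  have h00 := fun i => hg.pd_zero_zero hρ hw i hp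
  have h11 := fun i => hg.pd_one_one hρ hf hf_pos hw i hp
  have h01 := fun i => (hg.pd_off_diag i hp).1
  have h10 := fun i => (hg.pd_off_diag i hp).2
  have he := (Real.exp_pos (2 * w p)).ne'
  unfold christoffel
  rw [hg.inv_eq hf_pos hp, Real.exp_neg]
  simp only [Fin.sum_univ_two, h00, h11, h01, h10, pd_zero_of_snd, pd_one_of_snd]
  refine ⟨?_, ?_, ?_, ?_, ?_, ?_, ?_, ?_⟩ <;> simp <;> field_simp

/-- The background metric is flat, so the conformal change formula has no zeroth order term. This
turns the Ricci flow into a scalar equation for `w`. -/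
theorem HasConformalFactor.scalarCurv_eq (hρ : 0 < ρ) (hf : ContDiffOn ℝ ∞ f (Set.Icc (-ρ) ρ))
    (hf_pos : ∀ σ ∈ Set.Icc (-ρ) ρ, 0 < f σ) (hw : ContDiffOn ℝ ∞ w (strip ρ))
    (hg : HasConformalFactor ρ f g w) {p : ℝ × ℝ} (hp : p ∈ strip ρ) :
    scalarCurv ρ g p = -2 * Real.exp (-(2 * w p)) * flatLaplacian ρ f w p := by
  have hFp := (hf_pos p.2 hp).ne'
  have hF := contDiffOn_comp_snd hf
  have hw1 := contDiffOn_pd hρ hw 1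
  have hw0 := contDiffOn_pd hρ hw 0
  have hch := fun {q : ℝ × ℝ} (hq : q ∈ strip ρ) => hg.christoffel_eq hρ hf hf_pos hw hq
  obtain ⟨c000, c001, c010, c011, c100, c101, c110, c111⟩ := hch hp
  have d000 : ∀ i, pd ρ i (christoffel ρ g 0 0 0) p = pd ρ i (pd ρ 0 w) p :=
    fun i => pd_congr (fun q hq => (hch hq).1) i hp
  have d001 : ∀ i, pd ρ i (christoffel ρ g 0 0 1) p = pd ρ i (pd ρ 1 w) p :=
    fun i => pd_congr (fun q hq => (hch hq).2.1) i hp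
  have d101 : ∀ i, pd ρ i (christoffel ρ g 1 0 1) p = pd ρ i (pd ρ 0 w) p :=
    fun i => pd_congr (fun q hq => (hch hq).2.2.2.2.2.1) i hp
  have d110 : ∀ i, pd ρ i (christoffel ρ g 1 1 0) p = pd ρ i (pd ρ 0 w) p :=
    fun i => pd_congr (fun q hq => (hch hq).2.2.2.2.2.2.1) i hp
  have d100 : pd ρ 1 (christoffel ρ g 1 0 0) p
      = -(2 * f p.2 * derivWithin f (Set.Icc (-ρ) ρ) p.2 * pd ρ 1 w p
        + f p.2 ^ 2 * pd ρ 1 (pd ρ 1 w) p) := by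
    rw [pd_congr (k := fun q => -1 * ((f q.2 * f q.2) * pd ρ 1 w q))
      (fun q hq => by simp only [(hch hq).2.2.2.2.1]; ring) 1 hp,
      pd_const_mul hρ ((hF.mul hF).mul hw1) _ hp, pd_mul hρ (hF.mul hF) hw1 hp,
      pd_mul hρ hF hF hp, pd_one_of_snd]
    ring
  have d011 : pd ρ 0 (christoffel ρ g 0 1 1) p = -pd ρ 0 (pd ρ 0 w) p / f p.2 ^ 2 := by
    have hi : ContDiffOn ℝ ∞ (fun q : ℝ × ℝ => -(f q.2 ^ 2)⁻¹) (strip ρ) :=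
      ((hF.pow 2).inv fun q hq => pow_ne_zero 2 (hf_pos q.2 hq).ne').neg
    rw [pd_congr (k := fun q => (fun q : ℝ × ℝ => -(f q.2 ^ 2)⁻¹) q * pd ρ 0 w q)
      (fun q hq => by simp only [(hch hq).2.2.2.1]; ring) 0 hp,
      pd_mul hρ hi hw0 hp, pd_zero_of_snd (fun y => -(f y ^ 2)⁻¹)]
    ring
  unfold scalarCurv ricci flatLaplacian
  rw [hg.inv_eq hf_pos hp]
  simp only [Fin.sum_univ_two, d000, d001, d101, d110, d100, d011, c000, c001, c010, c011, c100,
    c101, c110, c111]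
  simp
  field_simp
  ring

/-- Prescribing the geodesic curvature thus becomes the nonlinear Neumann condition `D w = c e^w`.
-/
theorem HasConformalFactor.geodesicCurv_eq (hρ : 0 < ρ) (hf : ContDiffOn ℝ ∞ f (Set.Icc (-ρ) ρ))
    (hf_pos : ∀ σ ∈ Set.Icc (-ρ) ρ, 0 < f σ) (hw : ContDiffOn ℝ ∞ w (strip ρ))
    (hg : HasConformalFactor ρ f g w) {p : ℝ × ℝ} (hp : p ∈ strip ρ) :
    geodesicCurv ρ g p = Real.sign p.2 * (f p.2 * pd ρ 1 w p) * Real.exp (-w p) := by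
  have hFp := hf_pos p.2 hp
  unfold geodesicCurv
  rw [(hg.christoffel_eq hρ hf hf_pos hw hp).2.2.2.2.1, hg.inv_eq hf_pos hp, hg p hp]
  have h : Real.sqrt (f p.2 ^ 2 * Real.exp (-(2 * w p))) = f p.2 * Real.exp (-w p) := by
    rw [Real.sqrt_eq_iff_mul_self_eq (by positivity) (by positivity), mul_mul_mul_comm,
      ← Real.exp_add]
    ring_nf
  have h2 : Real.exp (2 * w p) = Real.exp (w p) * Real.exp (w p) := by
    rw [← Real.exp_add]; ring_nf
  have := (Real.exp_pos (w p)).ne'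
  simp only [Matrix.of_apply, Matrix.cons_val', Matrix.cons_val_zero, Matrix.cons_val_one,
    Matrix.cons_val_fin_one, h]
  rw [h2, Real.exp_neg]
  field_simp

theorem hasConformalFactor_warpedMetric (hf_pos : ∀ σ ∈ Set.Icc (-ρ) ρ, 0 < f σ) :
    HasConformalFactor ρ f (warpedMetric f) (fun p => Real.log (f p.2)) := by
  intro p hp
  have hFp := hf_pos p.2 hp
  have h : Real.exp (2 * Real.log (f p.2)) = f p.2 ^ 2 := by
    rw [mul_comm, Real.exp_mul, Real.exp_log hFp]; norm_cast
  rw [h, div_self (by positivity), warpedMetric]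

theorem HasConformalFactor.det_eq (hf_pos : ∀ σ ∈ Set.Icc (-ρ) ρ, 0 < f σ)
    (hg : HasConformalFactor ρ f g w) {p : ℝ × ℝ} (hp : p ∈ strip ρ) :
    Real.sqrt (g p).det = Real.exp (2 * w p) / f p.2 := by
  have hFp := hf_pos p.2 hp
  rw [hg p hp, Matrix.det_fin_two_of, Real.sqrt_eq_iff_mul_self_eq]
  · field_simp; ring
  · have := Real.exp_pos (2 * w p)
    simp only [mul_zero, sub_zero]; positivity
  · positivity

end ConformalMetric

/-! ### The initial conformal factor `log f`. -/

section LogWarping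

variable {ρ : ℝ} {f : ℝ → ℝ}

theorem contDiffOn_log_warping (hf : ContDiffOn ℝ ∞ f (Set.Icc (-ρ) ρ))
    (hf_pos : ∀ σ ∈ Set.Icc (-ρ) ρ, 0 < f σ) :
    ContDiffOn ℝ ∞ (fun p : ℝ × ℝ => Real.log (f p.2)) (strip ρ) :=
  (contDiffOn_comp_snd hf).log fun p hp => (hf_pos p.2 hp).ne'

theorem pd_one_log_warping (hρ : 0 < ρ) (hf : ContDiffOn ℝ ∞ f (Set.Icc (-ρ) ρ))
    (hf_pos : ∀ σ ∈ Set.Icc (-ρ) ρ, 0 < f σ) {p : ℝ × ℝ} (hp : p ∈ strip ρ) :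
    pd ρ 1 (fun p => Real.log (f p.2)) p = derivWithin f (Set.Icc (-ρ) ρ) p.2 / f p.2 := by
  rw [pd_one_of_snd (fun y => Real.log (f y))]
  exact derivWithin.log (hf.differentiableOn (by simp) _ hp) (hf_pos _ hp).ne'
    (uniqueDiffOn_Icc (by linarith) _ hp)

/-- Since `D log f = f'`, a second application of `D = f ∂_σ` gives `f f''`. The sign of the
curvature is therefore that of `-f''`. -/
theorem flatLaplacian_log_warping (hρ : 0 < ρ) (hf : ContDiffOn ℝ ∞ f (Set.Icc (-ρ) ρ))
    (hf_pos : ∀ σ ∈ Set.Icc (-ρ) ρ, 0 < f σ) {p : ℝ × ℝ} (hp : p ∈ strip ρ) :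
    flatLaplacian ρ f (fun p => Real.log (f p.2)) p
      = f p.2 * derivWithin (derivWithin f (Set.Icc (-ρ) ρ)) (Set.Icc (-ρ) ρ) p.2 := by
  have hFp := hf_pos p.2 hp
  have hw := contDiffOn_pd hρ (contDiffOn_log_warping hf hf_pos) 1
  have hF := contDiffOn_comp_snd hf
  have key : pd ρ 1 (fun q => f q.2 * pd ρ 1 (fun p => Real.log (f p.2)) q) p
      = pd ρ 1 (fun q => derivWithin f (Set.Icc (-ρ) ρ) q.2) p :=
    pd_congr (fun q hq => by
      have := hf_pos q.2 hq
      simp only [pd_one_log_warping hρ hf hf_pos hq]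
      field_simp) 1 hp
  rw [pd_mul hρ hF hw hp, pd_one_of_snd, pd_one_of_snd] at key
  have h0 : pd ρ 0 (pd ρ 0 (fun p => Real.log (f p.2))) p = 0 := by
    rw [pd_congr (k := fun _ => 0)
      (fun q _ => pd_zero_of_snd (fun y => Real.log (f y))) 0 hp, pd_const]
  rw [flatLaplacian, key, h0, zero_add]

end LogWarping

/-! ### Derivatives on space-time at positive times. -/

section SpaceTime

/-- The space-time `(0, T) × M`. -/
def posSpaceTime (ρ : ℝ) (T : EReal) : Set (ℝ × (ℝ × ℝ)) :=
  {q | 0 < q.1 ∧ (q.1 : EReal) < T ∧ q.2 ∈ strip ρ}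

/-- The time direction. -/
def timeVec : ℝ × (ℝ × ℝ) := (1, 0)

/-- The coordinate directions in space. -/
def spaceVec (i : Fin 2) : ℝ × (ℝ × ℝ) := (0, stripVec i)

variable {ρ : ℝ} {T : EReal}

theorem posSpaceTime_eq_prod (ρ : ℝ) (T : EReal) :
    posSpaceTime ρ T = {t : ℝ | 0 < t ∧ (t : EReal) < T} ×ˢ (Set.univ ×ˢ Set.Icc (-ρ) ρ) := by
  ext q
  simp [posSpaceTime, strip, and_assoc]

theorem posSpaceTime_subset : posSpaceTime ρ T ⊆ spaceTime ρ T :=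
  fun _ hq => ⟨hq.1.le, hq.2⟩

theorem isOpen_positive_times (T : EReal) : IsOpen {t : ℝ | 0 < t ∧ (t : EReal) < T} :=
  (isOpen_lt continuous_const continuous_id).inter
    (isOpen_lt continuous_coe_real_ereal continuous_const)

theorem uniqueDiffOn_posSpaceTime (hρ : 0 < ρ) : UniqueDiffOn ℝ (posSpaceTime ρ T) := by
  rw [posSpaceTime_eq_prod]
  exact (isOpen_positive_times T).uniqueDiffOn.prod
    (uniqueDiffOn_univ.prod (uniqueDiffOn_Icc (by linarith)))

theorem posSpaceTime_subset_closure (hρ : 0 < ρ) :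
    posSpaceTime ρ T ⊆ closure (interior (posSpaceTime ρ T)) := by
  rw [posSpaceTime_eq_prod, interior_prod_eq, interior_prod_eq, closure_prod_eq, closure_prod_eq,
    (isOpen_positive_times T).interior_eq, interior_Icc, interior_univ, closure_univ,
    closure_Ioo (by linarith)]
  exact Set.prod_mono subset_closure subset_rfl

variable {H : ℝ × (ℝ × ℝ) → ℝ} {q : ℝ × (ℝ × ℝ)}

theorem hasDerivAt_time (hH : ContDiffOn ℝ ∞ H (posSpaceTime ρ T)) (hq : q ∈ posSpaceTime ρ T) :
    HasDerivAt (fun s => H (s, q.2)) (dirDeriv (posSpaceTime ρ T) timeVec H q) q.1 := by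
  refine HasDerivWithinAt.hasDerivAt (s := {t : ℝ | 0 < t ∧ (t : EReal) < T}) ?_
    ((isOpen_positive_times T).mem_nhds ⟨hq.1, hq.2.1⟩)
  refine hasDerivWithinAt_dirDeriv (γ := fun s => (s, q.2)) hH ?_
    (fun s hs => ⟨hs.1, hs.2, hq.2.2⟩) hq
  exact (hasDerivWithinAt_id _ _).prodMk (hasDerivWithinAt_const _ _ _)

theorem contDiffOn_slice (hH : ContDiffOn ℝ ∞ H (posSpaceTime ρ T)) {t : ℝ} (ht : 0 < t)
    (htT : (t : EReal) < T) : ContDiffOn ℝ ∞ (fun p => H (t, p)) (strip ρ) :=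
  hH.comp (contDiff_prodMk_right t).contDiffOn fun _ hp => ⟨ht, htT, hp⟩

theorem pd_slice (hρ : 0 < ρ) (hH : ContDiffOn ℝ ∞ H (posSpaceTime ρ T)) (i : Fin 2)
    (hq : q ∈ posSpaceTime ρ T) :
    pd ρ i (fun p => H (q.1, p)) q.2 = dirDeriv (posSpaceTime ρ T) (spaceVec i) H q := by
  have hd : HasFDerivWithinAt H (fderivWithin ℝ H (posSpaceTime ρ T) q) (posSpaceTime ρ T)
      ((fun p : ℝ × ℝ => (q.1, p)) q.2) :=
    (differentiableWithinAt_of_contDiffOn hH hq).hasFDerivWithinAt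
  have h2 : HasFDerivWithinAt (fun p : ℝ × ℝ => (q.1, p)) (ContinuousLinearMap.inr ℝ ℝ (ℝ × ℝ))
      (strip ρ) q.2 := (hasFDerivAt_prodMk_right q.1 q.2).hasFDerivWithinAt
  have hmaps : Set.MapsTo (fun p : ℝ × ℝ => (q.1, p)) (strip ρ) (posSpaceTime ρ T) :=
    fun p hp => ⟨hq.1, hq.2.1, hp⟩
  have h3 := hd.comp q.2 h2 hmaps
  rw [pd_eq_dirDeriv hρ (contDiffOn_slice hH hq.1 hq.2.1) i hq.2.2, dirDeriv]
  have h4 := h3.fderivWithin (uniqueDiffOn_strip hρ q.2 hq.2.2)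
  change fderivWithin ℝ (H ∘ fun p : ℝ × ℝ => (q.1, p)) (strip ρ) q.2 (stripVec i) = _
  rw [h4]
  simp [dirDeriv, spaceVec]

theorem hasDerivAt_angle (hρ : 0 < ρ) (hH : ContDiffOn ℝ ∞ H (posSpaceTime ρ T))
    (hq : q ∈ posSpaceTime ρ T) :
    HasDerivAt (fun x => H (q.1, (x, q.2.2)))
      (dirDeriv (posSpaceTime ρ T) (spaceVec 0) H q) q.2.1 := by
  have hs := contDiffOn_slice hH hq.1 hq.2.1
  rw [← pd_slice hρ hH 0 hq, pd_eq_dirDeriv hρ hs 0 hq.2.2]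
  exact hasDerivAt_dirDeriv_strip hs hq.2.2

theorem hasDerivWithinAt_height (hρ : 0 < ρ) (hH : ContDiffOn ℝ ∞ H (posSpaceTime ρ T))
    (hq : q ∈ posSpaceTime ρ T) :
    HasDerivWithinAt (fun y => H (q.1, (q.2.1, y)))
      (dirDeriv (posSpaceTime ρ T) (spaceVec 1) H q) (Set.Icc (-ρ) ρ) q.2.2 := by
  have hs := contDiffOn_slice hH hq.1 hq.2.1
  rw [← pd_slice hρ hH 1 hq, pd_eq_dirDeriv hρ hs 1 hq.2.2]
  exact hasDerivWithinAt_dirDeriv_strip hs hq.2.2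

end SpaceTime

/-! ### First and second order conditions at a maximum in one variable. -/

section OneVariable

theorem deriv_nonneg_of_max_at_right {φ : ℝ → ℝ} {d l r : ℝ} (hlr : l < r)
    (hφ : HasDerivWithinAt φ d (Set.Icc l r) r) (hmax : ∀ x ∈ Set.Icc l r, φ x ≤ φ r) : 0 ≤ d := by
  have h := IsLocalMaxOn.hasFDerivWithinAt_nonpos (s := Set.Icc l r) (a := r) (y := l - r)
    (Filter.eventually_of_mem self_mem_nhdsWithin hmax) hφ.hasFDerivWithinAt
    (sub_mem_posTangentConeAt_of_segment_subset (by
      rw [segment_symm, segment_eq_Icc hlr.le]))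
  simp at h
  nlinarith

theorem deriv_nonpos_of_max_at_left {φ : ℝ → ℝ} {d l r : ℝ} (hlr : l < r)
    (hφ : HasDerivWithinAt φ d (Set.Icc l r) l) (hmax : ∀ x ∈ Set.Icc l r, φ x ≤ φ l) : d ≤ 0 := by
  have h := IsLocalMaxOn.hasFDerivWithinAt_nonpos (s := Set.Icc l r) (a := l) (y := r - l)
    (Filter.eventually_of_mem self_mem_nhdsWithin hmax) hφ.hasFDerivWithinAt
    (sub_mem_posTangentConeAt_of_segment_subset (by rw [segment_eq_Icc hlr.le]))
  simp at h
  nlinarith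

theorem second_deriv_nonpos_of_max {φ φ₁ : ℝ → ℝ} {d x : ℝ}
    (h1 : ∀ᶠ y in nhds x, HasDerivAt φ (φ₁ y) y) (h2 : HasDerivAt φ₁ d x)
    (hmax : IsLocalMax φ x) : d ≤ 0 := by
  by_contra! hd
  have hder : deriv φ =ᶠ[nhds x] φ₁ := h1.mono fun y hy => hy.deriv
  have hmin : IsLocalMin φ x := isLocalMin_of_deriv_deriv_pos
    (by rw [hder.deriv_eq, h2.deriv]; exact hd) hmax.deriv_eq_zero h1.self_of_nhds.continuousAt
  -- A positive second derivative would make `x` a local minimum as well as a maximum, so `φ` would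
  -- be constant near `x`, contradicting `0 < d`.
  have hconst : φ =ᶠ[nhds x] fun _ => φ x := by
    filter_upwards [hmax, hmin] with y hy hy' using le_antisymm hy hy'
  have h3 : deriv φ =ᶠ[nhds x] fun _ => 0 := by
    have := hconst.deriv
    simpa using this
  have h4 : φ₁ =ᶠ[nhds x] fun _ => 0 := hder.symm.trans h3
  have h5 := h4.deriv_eq
  rw [h2.deriv] at h5
  simp at h5
  linarith

end OneVariable

/-! ### The parabolic maximum principle with boundary. -/

section MaximumPrinciple

variable {ρ : ℝ} {T : EReal}

theorem mem_posSpaceTime_of_mem {q q' : ℝ × (ℝ × ℝ)} (hq : q ∈ posSpaceTime ρ T) (h : q'.1 = q.1)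
    (h' : q'.2 ∈ strip ρ) : q' ∈ posSpaceTime ρ T := by
  refine ⟨?_, ?_, h'⟩
  · rw [h]; exact hq.1
  · rw [h]; exact hq.2.1

/-- First and second order conditions in space and time at a point where `H` touches the barrier
`M e^{Λ t} (1 + σ²)` from below. -/
theorem touching_barrier (hρ : 0 < ρ) {H : ℝ × (ℝ × ℝ) → ℝ}
    (hH : ContDiffOn ℝ ∞ H (posSpaceTime ρ T)) {q : ℝ × (ℝ × ℝ)} (hq : q ∈ posSpaceTime ρ T)
    {M L : ℝ} (hM : 0 < M)
    (hle : ∀ q' ∈ spaceTime ρ T, q'.1 ≤ q.1 → H q' ≤ M * Real.exp (L * q'.1) * (1 + q'.2.2 ^ 2))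
    (heq : H q = M * Real.exp (L * q.1) * (1 + q.2.2 ^ 2)) :
    L * H q ≤ dirDeriv (posSpaceTime ρ T) timeVec H q ∧
    dirDeriv (posSpaceTime ρ T) (spaceVec 0) (dirDeriv (posSpaceTime ρ T) (spaceVec 0) H) q ≤ 0 ∧
    (q.2.2 = ρ → 0 < dirDeriv (posSpaceTime ρ T) (spaceVec 1) H q) ∧
    (q.2.2 = -ρ → dirDeriv (posSpaceTime ρ T) (spaceVec 1) H q < 0) ∧
    (q.2.2 ∈ Set.Ioo (-ρ) ρ →
      dirDeriv (posSpaceTime ρ T) (spaceVec 1) H q = 2 * q.2.2 * (M * Real.exp (L * q.1)) ∧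
      dirDeriv (posSpaceTime ρ T) (spaceVec 1) (dirDeriv (posSpaceTime ρ T) (spaceVec 1) H) q
        ≤ 2 * (M * Real.exp (L * q.1))) := by
  have hS := uniqueDiffOn_posSpaceTime (T := T) hρ
  set N := M * Real.exp (L * q.1) with hN
  have hNpos : 0 < N := by positivity
  have hheight : ∀ y ∈ Set.Icc (-ρ) ρ,
      H (q.1, (q.2.1, y)) - N * (1 + y ^ 2) ≤ H (q.1, (q.2.1, q.2.2)) - N * (1 + q.2.2 ^ 2) := by
    intro y hy
    have h1 := hle (q.1, (q.2.1, y)) ⟨hq.1.le, hq.2.1, hy⟩ le_rfl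
    have h2 : H (q.1, (q.2.1, q.2.2)) = N * (1 + q.2.2 ^ 2) := heq
    simp only at h1
    linarith
  have hder : HasDerivWithinAt (fun y => H (q.1, (q.2.1, y)) - N * (1 + y ^ 2))
      (dirDeriv (posSpaceTime ρ T) (spaceVec 1) H q - N * (2 * q.2.2)) (Set.Icc (-ρ) ρ) q.2.2 := by
    refine (hasDerivWithinAt_height hρ hH hq).sub ?_
    have := (((hasDerivAt_pow 2 q.2.2).const_add 1).const_mul N).hasDerivWithinAt
      (s := Set.Icc (-ρ) ρ)
    simpa using this
  refine ⟨?_, ?_, ?_, ?_, ?_⟩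
  · have h1 : HasDerivAt (fun s => H (s, q.2) - M * Real.exp (L * s) * (1 + q.2.2 ^ 2))
        (dirDeriv (posSpaceTime ρ T) timeVec H q - L * H q) q.1 := by
      refine (hasDerivAt_time hH hq).sub ?_
      have := ((((hasDerivAt_id q.1).const_mul L).exp).const_mul M).mul_const (1 + q.2.2 ^ 2)
      refine this.congr_deriv ?_
      rw [heq, hN]
      simp only [id]
      ring
    -- The barrier dominates only up to the time of contact, so this is a one-sided condition: an
    -- inequality for the time derivative.
    have := deriv_nonneg_of_max_at_right hq.1 (h1.hasDerivWithinAt (s := Set.Icc 0 q.1)) (by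
      intro s hs
      have h2 := hle (s, q.2) ⟨hs.1, lt_of_le_of_lt (EReal.coe_le_coe_iff.2 hs.2) hq.2.1, hq.2.2⟩ hs.2
      have h3 : H (q.1, q.2) = N * (1 + q.2.2 ^ 2) := heq
      simp only at h2
      rw [h3, hN]
      linarith)
    linarith
  · refine second_deriv_nonpos_of_max (φ := fun x => H (q.1, (x, q.2.2)))
      (φ₁ := fun x => dirDeriv (posSpaceTime ρ T) (spaceVec 0) H (q.1, (x, q.2.2))) (x := q.2.1)
      (Filter.Eventually.of_forall fun x => ?_) ?_ (Filter.Eventually.of_forall fun x => ?_)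
    · exact hasDerivAt_angle hρ hH (q := (q.1, (x, q.2.2)))
        (mem_posSpaceTime_of_mem hq rfl hq.2.2)
    · exact hasDerivAt_angle hρ (contDiffOn_dirDeriv hS hH _) hq
    · have h1 := hle (q.1, (x, q.2.2)) ⟨hq.1.le, hq.2.1, hq.2.2⟩ le_rfl
      exact h1.trans_eq heq.symm
  · intro h
    rw [h] at hder hheight
    have := deriv_nonneg_of_max_at_right (by linarith) hder hheight
    nlinarith
  · intro h
    rw [h] at hder hheight
    have := deriv_nonpos_of_max_at_left (by linarith) hder hheight
    nlinarith
  · intro h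
    have hmax : IsLocalMax (fun y => H (q.1, (q.2.1, y)) - N * (1 + y ^ 2)) q.2.2 :=
      Filter.eventually_of_mem (Icc_mem_nhds h.1 h.2) hheight
    have hd1 : ∀ y ∈ Set.Ioo (-ρ) ρ, HasDerivAt (fun y => H (q.1, (q.2.1, y)) - N * (1 + y ^ 2))
        (dirDeriv (posSpaceTime ρ T) (spaceVec 1) H (q.1, (q.2.1, y)) - N * (2 * y)) y := by
      intro y hy
      refine HasDerivAt.sub ?_ ?_
      · exact (hasDerivWithinAt_height hρ hH (q := (q.1, (q.2.1, y)))
          (mem_posSpaceTime_of_mem hq rfl (Set.Ioo_subset_Icc_self hy))).hasDerivAt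
          (Icc_mem_nhds hy.1 hy.2)
      · simpa using ((hasDerivAt_pow 2 y).const_add 1).const_mul N
    have hd2 : HasDerivAt
        (fun y => dirDeriv (posSpaceTime ρ T) (spaceVec 1) H (q.1, (q.2.1, y)) - N * (2 * y))
        (dirDeriv (posSpaceTime ρ T) (spaceVec 1) (dirDeriv (posSpaceTime ρ T) (spaceVec 1) H) q
          - N * 2) q.2.2 := by
      refine HasDerivAt.sub ?_ ?_
      · exact (hasDerivWithinAt_height hρ (contDiffOn_dirDeriv hS hH _) hq).hasDerivAt
          (Icc_mem_nhds h.1 h.2)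
      · simpa using ((hasDerivAt_id q.2.2).const_mul 2).const_mul N
    have e1 := hmax.hasDerivAt_eq_zero (hd1 q.2.2 h)
    have e2 := second_deriv_nonpos_of_max
      (Filter.eventually_of_mem (Ioo_mem_nhds h.1 h.2) hd1) hd2 hmax
    constructor
    · change dirDeriv (posSpaceTime ρ T) (spaceVec 1) H q - N * (2 * q.2.2) = 0 at e1
      linarith
    · linarith

/-- The weak maximum principle for linear parabolic inequalities on the cylinder, with a sign
condition on the outward derivative at the boundary. -/
theorem parabolic_nonpos (hρ : 0 < ρ) {f : ℝ → ℝ} (hf : ContDiffOn ℝ ∞ f (Set.Icc (-ρ) ρ))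
    {H a b c : ℝ × (ℝ × ℝ) → ℝ}
    (hH : ContDiffOn ℝ ∞ H (posSpaceTime ρ T)) (hcont : ContinuousOn H (spaceTime ρ T))
    (hper : ∀ q ∈ spaceTime ρ T, H (q.1, (q.2.1 + 2 * Real.pi, q.2.2)) = H q)
    (ha : ContinuousOn a (spaceTime ρ T)) (hb : ContinuousOn b (spaceTime ρ T))
    (hc : ContinuousOn c (spaceTime ρ T)) (ha0 : ∀ q ∈ posSpaceTime ρ T, 0 ≤ a q)
    (hineq : ∀ q ∈ posSpaceTime ρ T, 0 < H q → dirDeriv (posSpaceTime ρ T) timeVec H q ≤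
      a q * (dirDeriv (posSpaceTime ρ T) (spaceVec 0) (dirDeriv (posSpaceTime ρ T) (spaceVec 0) H) q
        + f q.2.2 * (derivWithin f (Set.Icc (-ρ) ρ) q.2.2
            * dirDeriv (posSpaceTime ρ T) (spaceVec 1) H q
          + f q.2.2 * dirDeriv (posSpaceTime ρ T) (spaceVec 1)
              (dirDeriv (posSpaceTime ρ T) (spaceVec 1) H) q))
      + b q * dirDeriv (posSpaceTime ρ T) (spaceVec 1) H q + c q * H q)
    (hright : ∀ q ∈ posSpaceTime ρ T, q.2.2 = ρ → 0 < H q →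
      dirDeriv (posSpaceTime ρ T) (spaceVec 1) H q ≤ 0)
    (hleft : ∀ q ∈ posSpaceTime ρ T, q.2.2 = -ρ → 0 < H q →
      0 ≤ dirDeriv (posSpaceTime ρ T) (spaceVec 1) H q)
    (hinit : ∀ p ∈ strip ρ, H (0, p) ≤ 0) :
    ∀ q ∈ spaceTime ρ T, H q ≤ 0 := by
  intro qs hqs
  by_contra! hpos
  have hpi := Real.pi_pos
  set K : Set (ℝ × (ℝ × ℝ)) := Set.Icc 0 qs.1 ×ˢ (Set.Icc 0 (2 * Real.pi) ×ˢ Set.Icc (-ρ) ρ) with hK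
  have hKc : IsCompact K := isCompact_Icc.prod (isCompact_Icc.prod isCompact_Icc)
  have hKs : K ⊆ spaceTime ρ T := fun q hq =>
    ⟨hq.1.1, lt_of_le_of_lt (EReal.coe_le_coe_iff.2 hq.1.2) hqs.2.1, hq.2.2⟩
  obtain ⟨A, hA⟩ := hKc.exists_bound_of_continuousOn (ha.mono hKs)
  obtain ⟨B, hB⟩ := hKc.exists_bound_of_continuousOn (hb.mono hKs)
  obtain ⟨C, hC⟩ := hKc.exists_bound_of_continuousOn (hc.mono hKs)
  obtain ⟨F, hF⟩ := isCompact_Icc.exists_bound_of_continuousOn hf.continuousOn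
  obtain ⟨F', hF'⟩ := isCompact_Icc.exists_bound_of_continuousOn
    (hf.continuousOn_derivWithin (uniqueDiffOn_Icc (by linarith)) (by simp))
  simp only [Real.norm_eq_abs] at hA hB hC hF hF'
  -- `L` exceeds by one the growth rate that the right-hand side can produce from the barrier: the
  -- first two `σ`-derivatives of `1 + σ²` are at most `2ρ` and `2` in absolute value, and the final
  -- `+ 1` gives the contradiction.
  set L : ℝ := A * (F * (F' * (2 * ρ) + F * 2)) + B * (2 * ρ) + C + 1 with hL
  -- Periodicity moves every point into the compact set `K`, so a maximum over `K` is global up to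
  -- the final time.
  have hrep : ∀ q ∈ spaceTime ρ T, ∃ x ∈ Set.Icc 0 (2 * Real.pi),
      H q = H (q.1, (x, q.2.2)) := by
    intro q hq
    have hp : Function.Periodic (fun x => H (q.1, (x, q.2.2))) (2 * Real.pi) :=
      fun x => hper (q.1, (x, q.2.2)) ⟨hq.1, hq.2.1, hq.2.2⟩
    obtain ⟨x, hx, hx'⟩ := hp.exists_mem_Ico₀ (by positivity) q.2.1
    exact ⟨x, Set.Ico_subset_Icc_self hx, hx'⟩
  -- The maximum `M` of this quotient is the height at which the barrier `M e^{Lt}(1 + σ²)` touches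
  -- `H` from above.
  set N : ℝ × (ℝ × ℝ) → ℝ := fun q => H q * Real.exp (-(L * q.1)) / (1 + q.2.2 ^ 2) with hNdef
  have hden : ∀ y : ℝ, 0 < 1 + y ^ 2 := fun y => by positivity
  have hNc : ContinuousOn N K := by
    refine ((hcont.mono hKs).mul (Continuous.continuousOn ?_)).div (Continuous.continuousOn ?_)
      fun q _ => (hden q.2.2).ne'
    · fun_prop
    · fun_prop
  obtain ⟨x0, hx0, hx0'⟩ := hrep qs hqs
  have hmem : (qs.1, (x0, qs.2.2)) ∈ K := ⟨⟨hqs.1, le_rfl⟩, hx0, hqs.2.2⟩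
  obtain ⟨q, hqK, hqmax⟩ := hKc.exists_isMaxOn ⟨_, hmem⟩ hNc
  have hqmax' : ∀ q' ∈ K, N q' ≤ N q := hqmax
  set M := N q with hM
  have hMpos : 0 < M := by
    refine lt_of_lt_of_le ?_ (hqmax' _ hmem)
    rw [hx0'] at hpos
    exact div_pos (mul_pos hpos (Real.exp_pos _)) (hden _)
  have hNH : ∀ q', H q' = N q' * Real.exp (L * q'.1) * (1 + q'.2.2 ^ 2) := by
    intro q'
    have h1 := (hden q'.2.2).ne'
    simp only [hNdef, Real.exp_neg]
    have h2 := (Real.exp_pos (L * q'.1)).ne'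
    field_simp
  have hle : ∀ q' ∈ spaceTime ρ T, q'.1 ≤ q.1 →
      H q' ≤ M * Real.exp (L * q'.1) * (1 + q'.2.2 ^ 2) := by
    intro q' hq' ht
    obtain ⟨x, hx, hx'⟩ := hrep q' hq'
    have h1 : (q'.1, (x, q'.2.2)) ∈ K := ⟨⟨hq'.1, ht.trans hqK.1.2⟩, hx, hq'.2.2⟩
    rw [hx', hNH]
    have h2 := hqmax' _ h1
    have := hden q'.2.2
    gcongr
  have hHq : H q = M * Real.exp (L * q.1) * (1 + q.2.2 ^ 2) := hNH q
  have hE : 0 < M * Real.exp (L * q.1) := by positivity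
  have hHpos : 0 < H q := by
    rw [hHq]
    exact mul_pos hE (hden _)
  have hqS : q ∈ posSpaceTime ρ T := by
    have h1 := hKs hqK
    refine ⟨lt_of_le_of_ne h1.1 ?_, h1.2⟩
    intro h0
    have h2 := hinit q.2 h1.2.2
    rw [show ((0 : ℝ), q.2) = q from Prod.ext h0 rfl] at h2
    exact absurd h2 (not_le.2 hHpos)
  obtain ⟨k1, k2, k3, k4, k5⟩ := touching_barrier hρ hH hqS hMpos hle hHq
  -- The factor `1 + σ²` increases strictly towards both boundary components, so contact there would
  -- give `H` a strictly positive outward derivative, against `hright` and `hleft`.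
  have hin : q.2.2 ∈ Set.Ioo (-ρ) ρ := by
    refine ⟨lt_of_le_of_ne hqK.2.2.1 fun h => ?_, lt_of_le_of_ne hqK.2.2.2 fun h => ?_⟩
    · exact absurd (hleft q hqS h.symm hHpos) (not_le.2 (k4 h.symm))
    · exact absurd (hright q hqS h hHpos) (not_le.2 (k3 h))
  obtain ⟨k6, k7⟩ := k5 hin
  have k8 := hineq q hqS hHpos
  set E := M * Real.exp (L * q.1)
  have hEH : E ≤ H q := by rw [hHq]; nlinarith [sq_nonneg q.2.2]
  have hy : |q.2.2| ≤ ρ := abs_le.2 ⟨hin.1.le, hin.2.le⟩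
  have hAq := hA q hqK
  have hBq := hB q hqK
  have hCq := hC q hqK
  have hFq := hF q.2.2 hqK.2.2
  have hFq' := hF' q.2.2 hqK.2.2
  have ha0q := ha0 q hqS
  rw [abs_of_nonneg ha0q] at hAq
  have hF0 : 0 ≤ F := (abs_nonneg _).trans hFq
  have hF0' : 0 ≤ F' := (abs_nonneg _).trans hFq'
  have hA0 : 0 ≤ A := ha0q.trans hAq
  have hB0 : 0 ≤ B := (abs_nonneg _).trans hBq
  set u := f q.2.2
  set u' := derivWithin f (Set.Icc (-ρ) ρ) q.2.2
  have m1 : u * (u' * (2 * q.2.2)) ≤ F * (F' * (2 * ρ)) := by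
    calc u * (u' * (2 * q.2.2)) ≤ |u * (u' * (2 * q.2.2))| := le_abs_self _
      _ = |u| * (|u'| * (2 * |q.2.2|)) := by simp [abs_mul]
      _ ≤ _ := by gcongr
  have m2 : u * u ≤ F * F := by
    calc u * u = |u| * |u| := (abs_mul_abs_self u).symm
      _ ≤ _ := by gcongr
  have m3 : b q * (2 * q.2.2) ≤ B * (2 * ρ) := by
    calc b q * (2 * q.2.2) ≤ |b q * (2 * q.2.2)| := le_abs_self _
      _ = |b q| * (2 * |q.2.2|) := by simp [abs_mul]
      _ ≤ _ := by gcongr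
  have m4 : u * (u' * (2 * q.2.2 * E)) + u * (u * (2 * E)) ≤ (F * (F' * (2 * ρ) + F * 2)) * E := by
    nlinarith
  set D2 := dirDeriv (posSpaceTime ρ T) (spaceVec 1) (dirDeriv (posSpaceTime ρ T) (spaceVec 1) H) q
  set D0 := dirDeriv (posSpaceTime ρ T) (spaceVec 0) (dirDeriv (posSpaceTime ρ T) (spaceVec 0) H) q
  rw [k6] at k8
  have m5 : u * (u * D2) ≤ u * (u * (2 * E)) := by
    rw [← mul_assoc, ← mul_assoc]
    exact mul_le_mul_of_nonneg_left k7 (mul_self_nonneg u)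
  have m6 : a q * (D0 + u * (u' * (2 * q.2.2 * E) + u * D2))
      ≤ A * (F * (F' * (2 * ρ) + F * 2)) * H q := by
    have n1 : D0 + u * (u' * (2 * q.2.2 * E) + u * D2) ≤ (F * (F' * (2 * ρ) + F * 2)) * E := by
      linarith
    have n2 : 0 ≤ F * (F' * (2 * ρ) + F * 2) := by positivity
    calc a q * (D0 + u * (u' * (2 * q.2.2 * E) + u * D2))
        ≤ a q * ((F * (F' * (2 * ρ) + F * 2)) * E) := mul_le_mul_of_nonneg_left n1 ha0q
      _ ≤ A * ((F * (F' * (2 * ρ) + F * 2)) * H q) := by gcongr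
      _ = _ := by ring
  have m7 : b q * (2 * q.2.2 * E) ≤ B * (2 * ρ) * H q := by
    calc b q * (2 * q.2.2 * E) = b q * (2 * q.2.2) * E := by ring
      _ ≤ B * (2 * ρ) * E := mul_le_mul_of_nonneg_right m3 hE.le
      _ ≤ _ := by gcongr
  have m8 : c q * H q ≤ C * H q :=
    mul_le_mul_of_nonneg_right ((le_abs_self _).trans hCq) hHpos.le
  have m9 : L * H q = A * (F * (F' * (2 * ρ) + F * 2)) * H q + B * (2 * ρ) * H q + C * H q + H q := by
    rw [hL]; ring
  linarith

end MaximumPrinciple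

/-! ### The linearised equation and the quantity `(DW)² - DDW`. -/

section Linearisation

variable {E : Type*} [NormedAddCommGroup E] [NormedSpace ℝ E]

/-- The derivative along the vector field `F y`. -/
noncomputable def scaledDeriv (S : Set E) (y : E) (F H : E → ℝ) (q : E) : ℝ :=
  F q * dirDeriv S y H q

variable {S : Set E} {F W H K : E → ℝ} {e t x y q : E}

theorem contDiffOn_scaledDeriv (hS : UniqueDiffOn ℝ S) (hF : ContDiffOn ℝ ∞ F S)
    (hH : ContDiffOn ℝ ∞ H S) (y : E) : ContDiffOn ℝ ∞ (scaledDeriv S y F H) S :=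
  hF.mul (contDiffOn_dirDeriv hS hH y)

theorem scaledDeriv_congr (h : Set.EqOn H K S) (hq : q ∈ S) :
    scaledDeriv S y F H q = scaledDeriv S y F K q := by
  unfold scaledDeriv
  rw [dirDeriv_congr h hq]

theorem scaledDeriv_scaledDeriv (hS : UniqueDiffOn ℝ S) (hF : ContDiffOn ℝ ∞ F S)
    (hH : ContDiffOn ℝ ∞ H S) (hq : q ∈ S) :
    scaledDeriv S y F (scaledDeriv S y F H) q
      = F q * (dirDeriv S y F q * dirDeriv S y H q + F q * dirDeriv S y (dirDeriv S y H) q) := by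
  rw [scaledDeriv]
  unfold scaledDeriv
  rw [dirDeriv_mul hS hF (contDiffOn_dirDeriv hS hH y) hq]

theorem dirDeriv_scaledDeriv (hS : UniqueDiffOn ℝ S) (hS' : S ⊆ closure (interior S))
    (hF : ContDiffOn ℝ ∞ F S) (hH : ContDiffOn ℝ ∞ H S) (he : ∀ q ∈ S, dirDeriv S e F q = 0)
    (hq : q ∈ S) :
    dirDeriv S e (scaledDeriv S y F H) q = scaledDeriv S y F (dirDeriv S e H) q := by
  unfold scaledDeriv
  rw [dirDeriv_mul hS hF (contDiffOn_dirDeriv hS hH y) hq, he q hq, dirDeriv_comm hS hS' hH hq]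
  ring

theorem scaledDeriv_eq_zero (h : ∀ q ∈ S, H q = 0) (hq : q ∈ S) : scaledDeriv S y F H q = 0 := by
  rw [scaledDeriv_congr (K := fun _ => 0) h hq, scaledDeriv, dirDeriv_const, mul_zero]

theorem dirDeriv_eq_zero (h : ∀ q ∈ S, H q = 0) (hq : q ∈ S) : dirDeriv S e H q = 0 := by
  rw [dirDeriv_congr (K := fun _ => 0) h hq, dirDeriv_const]

theorem dirDeriv_exp_mul (hS : UniqueDiffOn ℝ S) (hW : ContDiffOn ℝ ∞ W S)
    (hH : ContDiffOn ℝ ∞ H S) (c : ℝ) (hq : q ∈ S) :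
    dirDeriv S e (fun x => Real.exp (c * W x) * H x) q
      = Real.exp (c * W q) * (c * dirDeriv S e W q * H q + dirDeriv S e H q) := by
  rw [dirDeriv_mul hS (contDiffOn_const.mul hW).exp hH hq, dirDeriv_exp hS (contDiffOn_const.mul hW) hq,
    dirDeriv_const_mul hS hW c hq]
  ring

/-- A derivative of a solution of `W_t = e^{-2W} (W_xx + DDW)` in a direction of symmetry of the
equation solves the linearised equation. -/
theorem linearised_equation (hS : UniqueDiffOn ℝ S) (hS' : S ⊆ closure (interior S))
    (hF : ContDiffOn ℝ ∞ F S) (hW : ContDiffOn ℝ ∞ W S) (he : ∀ q ∈ S, dirDeriv S e F q = 0)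
    (hev : ∀ q ∈ S, dirDeriv S t W q = Real.exp (-2 * W q) *
      (dirDeriv S x (dirDeriv S x W) q + scaledDeriv S y F (scaledDeriv S y F W) q)) (hq : q ∈ S) :
    dirDeriv S t (dirDeriv S e W) q = Real.exp (-2 * W q) *
      (dirDeriv S x (dirDeriv S x (dirDeriv S e W)) q
        + scaledDeriv S y F (scaledDeriv S y F (dirDeriv S e W)) q)
      - 2 * dirDeriv S t W q * dirDeriv S e W q := by
  have hWx := contDiffOn_dirDeriv hS hW x
  have hDW := contDiffOn_scaledDeriv hS hF hW y
  have hWxx := contDiffOn_dirDeriv hS hWx x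
  have hDDW := contDiffOn_scaledDeriv hS hF hDW y
  have h1 : dirDeriv S e (dirDeriv S x (dirDeriv S x W)) q
      = dirDeriv S x (dirDeriv S x (dirDeriv S e W)) q := by
    rw [dirDeriv_comm hS hS' hWx hq]
    exact dirDeriv_congr (fun z hz => dirDeriv_comm hS hS' hW hz) hq
  have h2 : dirDeriv S e (scaledDeriv S y F (scaledDeriv S y F W)) q
      = scaledDeriv S y F (scaledDeriv S y F (dirDeriv S e W)) q := by
    rw [dirDeriv_scaledDeriv hS hS' hF hDW he hq]
    exact scaledDeriv_congr (fun z hz => dirDeriv_scaledDeriv hS hS' hF hW he hz) hq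
  rw [dirDeriv_comm hS hS' hW hq, dirDeriv_congr hev hq,
    dirDeriv_exp_mul hS hW (hWxx.add hDDW) (-2) hq, dirDeriv_add hS hWxx hDDW hq, h1, h2, hev q hq]
  ring

/-- For a solution independent of `x`, the evolution of `Z = (DW)² - DDW`. -/
theorem gradient_quantity_equations (hS : UniqueDiffOn ℝ S) (hS' : S ⊆ closure (interior S))
    (hF : ContDiffOn ℝ ∞ F S) (hW : ContDiffOn ℝ ∞ W S) (ht : ∀ q ∈ S, dirDeriv S t F q = 0)
    (hx : ∀ q ∈ S, dirDeriv S x F q = 0)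
    (hev : ∀ q ∈ S, dirDeriv S t W q = Real.exp (-2 * W q) *
      (dirDeriv S x (dirDeriv S x W) q + scaledDeriv S y F (scaledDeriv S y F W) q))
    (hWx : ∀ q ∈ S, dirDeriv S x W q = 0)
    {Z : E → ℝ} (hZ : Z = fun q => scaledDeriv S y F W q * scaledDeriv S y F W q
      - scaledDeriv S y F (scaledDeriv S y F W) q) (hq : q ∈ S) :
    dirDeriv S x (dirDeriv S x Z) q = 0 ∧
    scaledDeriv S y F Z q = -(Real.exp (2 * W q) * scaledDeriv S y F (dirDeriv S t W) q) ∧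
    dirDeriv S t Z q = Real.exp (-2 * W q) * scaledDeriv S y F (scaledDeriv S y F Z) q
      - 4 * Real.exp (-2 * W q) * scaledDeriv S y F W q * scaledDeriv S y F Z q := by
  have hP := contDiffOn_scaledDeriv hS hF hW y
  have hDP := contDiffOn_scaledDeriv hS hF hP y
  have hQ := contDiffOn_dirDeriv hS hW t
  have hDQ := contDiffOn_scaledDeriv hS hF hQ y
  have hexp : ∀ z, Real.exp (2 * W z) * Real.exp (-2 * W z) = 1 := fun z => by
    rw [← Real.exp_add]; simp
  have hWxx : ∀ z ∈ S, dirDeriv S x (dirDeriv S x W) z = 0 := fun z hz => dirDeriv_eq_zero hWx hz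
  -- Without dependence on `x`, the evolution equation itself expresses `DDW` through `W_t`;
  -- replacing `DDW` in `Z` lowers the order of every later derivative.
  have hDPeq : ∀ z ∈ S, scaledDeriv S y F (scaledDeriv S y F W) z
      = Real.exp (2 * W z) * dirDeriv S t W z := by
    intro z hz
    rw [hev z hz, hWxx z hz, ← mul_assoc, hexp]
    ring
  have hZ' : Set.EqOn Z (fun q => scaledDeriv S y F W q * scaledDeriv S y F W q
      - Real.exp (2 * W q) * dirDeriv S t W q) S := fun z hz => by
    simp only [hZ, hDPeq z hz]
  have hPP := hP.mul hP
  have heQ : ContDiffOn ℝ ∞ (fun q => Real.exp (2 * W q) * dirDeriv S t W q) S :=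
    (contDiffOn_const.mul hW).exp.mul hQ
  have hder : ∀ e : E, ∀ z ∈ S, dirDeriv S e Z z
      = 2 * scaledDeriv S y F W z * dirDeriv S e (scaledDeriv S y F W) z
        - Real.exp (2 * W z) * (2 * dirDeriv S e W z * dirDeriv S t W z
          + dirDeriv S e (dirDeriv S t W) z) := by
    intro e z hz
    rw [dirDeriv_congr hZ' hz, dirDeriv_sub hS hPP heQ hz, dirDeriv_mul hS hP hP hz,
      dirDeriv_exp_mul hS hW hQ 2 hz]
    ring
  have hQx : ∀ z ∈ S, dirDeriv S x (dirDeriv S t W) z = 0 := fun z hz => by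
    rw [dirDeriv_comm hS hS' hW hz]
    exact dirDeriv_eq_zero hWx hz
  have hPx : ∀ z ∈ S, dirDeriv S x (scaledDeriv S y F W) z = 0 := fun z hz => by
    rw [dirDeriv_scaledDeriv hS hS' hF hW hx hz]
    exact scaledDeriv_eq_zero hWx hz
  have hDZ : ∀ z ∈ S, scaledDeriv S y F Z z
      = -(Real.exp (2 * W z) * scaledDeriv S y F (dirDeriv S t W) z) := by
    intro z hz
    have h1 := hDPeq z hz
    have h2 : scaledDeriv S y F W z = F z * dirDeriv S y W z := rfl
    rw [scaledDeriv] at h1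
    change F z * dirDeriv S y Z z
      = -(Real.exp (2 * W z) * (F z * dirDeriv S y (dirDeriv S t W) z))
    rw [hder y z hz]
    linear_combination (2 * scaledDeriv S y F W z) * h1
      + (2 * Real.exp (2 * W z) * dirDeriv S t W z) * h2
  have hDDZ : scaledDeriv S y F (scaledDeriv S y F Z) q
      = -(Real.exp (2 * W q) * (2 * scaledDeriv S y F W q * scaledDeriv S y F (dirDeriv S t W) q
        + scaledDeriv S y F (scaledDeriv S y F (dirDeriv S t W)) q)) := by
    rw [scaledDeriv_congr (K := fun z => -1 * (Real.exp (2 * W z)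
        * scaledDeriv S y F (dirDeriv S t W) z)) (fun z hz => by rw [hDZ z hz]; ring) hq]
    rw [scaledDeriv, dirDeriv_const_mul hS ((contDiffOn_const.mul hW).exp.mul hDQ) _ hq,
      dirDeriv_exp_mul hS hW hDQ 2 hq]
    rw [show scaledDeriv S y F W q = F q * dirDeriv S y W q from rfl,
      show scaledDeriv S y F (scaledDeriv S y F (dirDeriv S t W)) q
        = F q * dirDeriv S y (scaledDeriv S y F (dirDeriv S t W)) q from rfl]
    ring
  refine ⟨?_, hDZ q hq, ?_⟩
  · refine dirDeriv_eq_zero (fun z hz => ?_) hq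
    rw [hder x z hz, hPx z hz, hWx z hz, hQx z hz]
    ring
  -- With `Q = W_t`, the terms in `Q²` cancel, leaving `Z_t = 2 DW DQ - DDQ`, while `e^{-2W} DDZ =
  -- -2 DW DQ - DDQ`. The difference `4 DW DQ` equals `-4 e^{-2W} DW DZ`.
  · have hQt := linearised_equation hS hS' hF hW ht hev hq
    rw [dirDeriv_eq_zero hQx hq, zero_add] at hQt
    rw [hDDZ, hDZ q hq, hder t q hq, dirDeriv_scaledDeriv hS hS' hF hW ht hq, hQt]
    linear_combination (-scaledDeriv S y F (scaledDeriv S y F (dirDeriv S t W)) q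
      + (2 * scaledDeriv S y F W q * scaledDeriv S y F (dirDeriv S t W) q
        + scaledDeriv S y F (scaledDeriv S y F (dirDeriv S t W)) q)
      - 4 * scaledDeriv S y F W q * scaledDeriv S y F (dirDeriv S t W) q) * hexp q

end Linearisation

/-! ### Congruence and periodicity of the flat Laplacian. -/

section FlatLaplacian

variable {ρ : ℝ} {f : ℝ → ℝ}

theorem pd_pd_congr {h k : ℝ × ℝ → ℝ} (H : Set.EqOn h k (strip ρ)) (i j : Fin 2) {p : ℝ × ℝ}
    (hp : p ∈ strip ρ) : pd ρ i (pd ρ j h) p = pd ρ i (pd ρ j k) p :=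
  pd_congr (fun _ hq => pd_congr H j hq) i hp

theorem flatLaplacian_congr {h k : ℝ × ℝ → ℝ} (H : Set.EqOn h k (strip ρ)) {p : ℝ × ℝ}
    (hp : p ∈ strip ρ) : flatLaplacian ρ f h p = flatLaplacian ρ f k p := by
  unfold flatLaplacian
  rw [pd_pd_congr H 0 0 hp, pd_pd_congr H 1 1 hp, pd_congr H 1 hp]

theorem flatLaplacian_periodic {h : ℝ × ℝ → ℝ} {c : ℝ}
    (H : ∀ p ∈ strip ρ, h (p.1 + c, p.2) = h p) {p : ℝ × ℝ} (hp : p ∈ strip ρ) :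
    flatLaplacian ρ f h (p.1 + c, p.2) = flatLaplacian ρ f h p := by
  unfold flatLaplacian
  rw [pd_periodic (fun q hq => pd_periodic H 0 hq) 0 hp, pd_periodic H 1 hp,
    pd_periodic (fun q hq => pd_periodic H 1 hq) 1 hp]

end FlatLaplacian

/-- The conformal factor of a Ricci flow with prescribed geodesic curvature: `e^{2W}` times the flat
metric `dθ² + dσ² / f²`, the boundary condition being `f W_σ = c e^W`. -/
structure IsConformalFlow (ρ : ℝ) (f : ℝ → ℝ) (T : EReal) (c : ℝ → ℝ)
    (W : ℝ × (ℝ × ℝ) → ℝ) : Prop where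
  smooth : ContDiffOn ℝ ∞ W (posSpaceTime ρ T)
  cont : ContinuousOn W (spaceTime ρ T)
  cont_one : ∀ i, ContinuousOn (fun q => pd ρ i (fun p => W (q.1, p)) q.2) (spaceTime ρ T)
  cont_two : ∀ i j,
    ContinuousOn (fun q => pd ρ i (pd ρ j (fun p => W (q.1, p))) q.2) (spaceTime ρ T)
  periodic : ∀ q ∈ spaceTime ρ T, W (q.1, (q.2.1 + 2 * Real.pi, q.2.2)) = W q
  evolution : ∀ q ∈ posSpaceTime ρ T, HasDerivAt (fun s => W (s, q.2))
    (Real.exp (-2 * W q) * flatLaplacian ρ f (fun p => W (q.1, p)) q.2) q.1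
  boundary : ∀ q ∈ posSpaceTime ρ T, q.2 ∈ bdry ρ →
    f q.2.2 * pd ρ 1 (fun p => W (q.1, p)) q.2 = c q.2.2 * Real.exp (W q)
  initial : ∀ p ∈ strip ρ, W (0, p) = Real.log (f p.2)

/-! ### Conformal flows and the maximum principle for their linearisation. -/

section ConformalFlow

variable {ρ : ℝ} {f : ℝ → ℝ} {T : EReal} {c : ℝ → ℝ} {W : ℝ × (ℝ × ℝ) → ℝ}

/-- The warping function on space-time. -/
def warping (f : ℝ → ℝ) (q : ℝ × (ℝ × ℝ)) : ℝ := f q.2.2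

theorem contDiffOn_warping (hf : ContDiffOn ℝ ∞ f (Set.Icc (-ρ) ρ)) :
    ContDiffOn ℝ ∞ (warping f) (posSpaceTime ρ T) :=
  hf.comp (contDiff_snd.comp contDiff_snd).contDiffOn fun _ hq => hq.2.2

theorem dirDeriv_time_warping (hf : ContDiffOn ℝ ∞ f (Set.Icc (-ρ) ρ)) :
    ∀ q ∈ posSpaceTime ρ T, dirDeriv (posSpaceTime ρ T) timeVec (warping f) q = 0 :=
  fun q hq => (hasDerivAt_time (contDiffOn_warping hf) hq).unique (hasDerivAt_const q.1 (f q.2.2))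

theorem dirDeriv_angle_warping (hρ : 0 < ρ) (hf : ContDiffOn ℝ ∞ f (Set.Icc (-ρ) ρ)) :
    ∀ q ∈ posSpaceTime ρ T, dirDeriv (posSpaceTime ρ T) (spaceVec 0) (warping f) q = 0 :=
  fun q hq => by
    rw [← pd_slice hρ (contDiffOn_warping hf) 0 hq]
    exact pd_zero_of_snd f

theorem dirDeriv_height_warping (hρ : 0 < ρ) (hf : ContDiffOn ℝ ∞ f (Set.Icc (-ρ) ρ)) :
    ∀ q ∈ posSpaceTime ρ T, dirDeriv (posSpaceTime ρ T) (spaceVec 1) (warping f) q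
      = derivWithin f (Set.Icc (-ρ) ρ) q.2.2 :=
  fun q hq => by
    rw [← pd_slice hρ (contDiffOn_warping hf) 1 hq]
    exact pd_one_of_snd f

theorem pd_pd_slice (hρ : 0 < ρ) {H : ℝ × (ℝ × ℝ) → ℝ} (hH : ContDiffOn ℝ ∞ H (posSpaceTime ρ T))
    (i j : Fin 2) {q : ℝ × (ℝ × ℝ)} (hq : q ∈ posSpaceTime ρ T) :
    pd ρ i (pd ρ j (fun p => H (q.1, p))) q.2
      = dirDeriv (posSpaceTime ρ T) (spaceVec i) (dirDeriv (posSpaceTime ρ T) (spaceVec j) H) q := by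
  rw [← pd_slice hρ (contDiffOn_dirDeriv (uniqueDiffOn_posSpaceTime hρ) hH _) i hq]
  exact pd_congr (fun p hp => pd_slice hρ hH j (q := (q.1, p)) (mem_posSpaceTime_of_mem hq rfl hp)) i
    hq.2.2

/-- The `σ`-part of the Laplacian is the square of the field `f ∂_σ`, the form in which the
linearised equations are derived. -/
theorem flatLaplacian_slice (hρ : 0 < ρ) (hf : ContDiffOn ℝ ∞ f (Set.Icc (-ρ) ρ))
    {H : ℝ × (ℝ × ℝ) → ℝ} (hH : ContDiffOn ℝ ∞ H (posSpaceTime ρ T))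
    {q : ℝ × (ℝ × ℝ)} (hq : q ∈ posSpaceTime ρ T) :
    flatLaplacian ρ f (fun p => H (q.1, p)) q.2
      = dirDeriv (posSpaceTime ρ T) (spaceVec 0) (dirDeriv (posSpaceTime ρ T) (spaceVec 0) H) q
        + scaledDeriv (posSpaceTime ρ T) (spaceVec 1) (warping f)
          (scaledDeriv (posSpaceTime ρ T) (spaceVec 1) (warping f) H) q := by
  rw [scaledDeriv_scaledDeriv (uniqueDiffOn_posSpaceTime hρ) (contDiffOn_warping hf) hH hq,
    dirDeriv_height_warping hρ hf q hq, flatLaplacian, pd_pd_slice hρ hH 0 0 hq,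
    pd_pd_slice hρ hH 1 1 hq, pd_slice hρ hH 1 hq]
  rfl

/-- The maximum principle in terms of the vector field `f ∂_σ`. -/
theorem parabolic_nonpos_of_scaledDeriv (hρ : 0 < ρ) (hf : ContDiffOn ℝ ∞ f (Set.Icc (-ρ) ρ))
    (hf_pos : ∀ σ ∈ Set.Icc (-ρ) ρ, 0 < f σ) {H K a b e : ℝ × (ℝ × ℝ) → ℝ}
    (hK : ContDiffOn ℝ ∞ K (posSpaceTime ρ T)) (hHK : Set.EqOn H K (posSpaceTime ρ T))
    (hcont : ContinuousOn H (spaceTime ρ T))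
    (hper : ∀ q ∈ spaceTime ρ T, H (q.1, (q.2.1 + 2 * Real.pi, q.2.2)) = H q)
    (ha : ContinuousOn a (spaceTime ρ T)) (hb : ContinuousOn b (spaceTime ρ T))
    (he : ContinuousOn e (spaceTime ρ T)) (ha0 : ∀ q ∈ posSpaceTime ρ T, 0 ≤ a q)
    (hineq : ∀ q ∈ posSpaceTime ρ T, dirDeriv (posSpaceTime ρ T) timeVec K q =
      a q * (dirDeriv (posSpaceTime ρ T) (spaceVec 0) (dirDeriv (posSpaceTime ρ T) (spaceVec 0) K) q
        + scaledDeriv (posSpaceTime ρ T) (spaceVec 1) (warping f)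
          (scaledDeriv (posSpaceTime ρ T) (spaceVec 1) (warping f) K) q)
      + b q * scaledDeriv (posSpaceTime ρ T) (spaceVec 1) (warping f) K q + e q * K q)
    (hright : ∀ q ∈ posSpaceTime ρ T, q.2.2 = ρ → 0 < K q →
      scaledDeriv (posSpaceTime ρ T) (spaceVec 1) (warping f) K q ≤ 0)
    (hleft : ∀ q ∈ posSpaceTime ρ T, q.2.2 = -ρ → 0 < K q →
      0 ≤ scaledDeriv (posSpaceTime ρ T) (spaceVec 1) (warping f) K q)
    (hinit : ∀ p ∈ strip ρ, H (0, p) ≤ 0) :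
    ∀ q ∈ spaceTime ρ T, H q ≤ 0 := by
  have hS := uniqueDiffOn_posSpaceTime (T := T) hρ
  have hd : ∀ v, ∀ q ∈ posSpaceTime ρ T,
      dirDeriv (posSpaceTime ρ T) v H q = dirDeriv (posSpaceTime ρ T) v K q :=
    fun v q hq => dirDeriv_congr hHK hq
  have hdd : ∀ u v, ∀ q ∈ posSpaceTime ρ T,
      dirDeriv (posSpaceTime ρ T) u (dirDeriv (posSpaceTime ρ T) v H) q
        = dirDeriv (posSpaceTime ρ T) u (dirDeriv (posSpaceTime ρ T) v K) q :=
    fun u v q hq => dirDeriv_congr (hd v) hq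
  -- `H` carries the continuity down to time zero and `K` the smoothness at positive times. The
  -- first order part of `D²` and the factor `f` in `b D` are absorbed into the coefficients of
  -- `∂_σ`.
  refine parabolic_nonpos (a := a) (b := fun q => b q * warping f q) (c := e) hρ hf (hK.congr hHK)
    hcont hper ha ?_ he ha0 ?_ ?_ ?_ hinit
  · exact hb.mul (hf.continuousOn.comp (continuous_snd.comp continuous_snd).continuousOn
      fun q hq => hq.2.2)
  · intro q hq _
    rw [hd _ q hq, hd _ q hq, hdd _ _ q hq, hdd _ _ q hq, hHK hq, hineq q hq,
      scaledDeriv_scaledDeriv hS (contDiffOn_warping hf) hK hq, dirDeriv_height_warping hρ hf q hq]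
    simp only [warping, scaledDeriv]
    exact le_of_eq (by ring)
  · intro q hq h hpos
    rw [hHK hq] at hpos
    rw [hd _ q hq]
    exact nonpos_of_mul_nonpos_right (hright q hq h hpos) (hf_pos _ hq.2.2)
  · intro q hq h hpos
    rw [hHK hq] at hpos
    rw [hd _ q hq]
    exact nonneg_of_mul_nonneg_right (hleft q hq h hpos) (hf_pos _ hq.2.2)

theorem continuousOn_warping (hf : ContDiffOn ℝ ∞ f (Set.Icc (-ρ) ρ)) :
    ContinuousOn (fun q : ℝ × (ℝ × ℝ) => f q.2.2) (spaceTime ρ T) :=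
  hf.continuousOn.comp (continuous_snd.comp continuous_snd).continuousOn fun _ hq => hq.2.2

namespace IsConformalFlow

variable (hρ : 0 < ρ) (hf : ContDiffOn ℝ ∞ f (Set.Icc (-ρ) ρ)) (hflow : IsConformalFlow ρ f T c W)

include hρ hf hflow

theorem continuousOn_flatLaplacian :
    ContinuousOn (fun q => flatLaplacian ρ f (fun p => W (q.1, p)) q.2) (spaceTime ρ T) := by
  have h1 : ContinuousOn (fun q : ℝ × (ℝ × ℝ) => derivWithin f (Set.Icc (-ρ) ρ) q.2.2)
      (spaceTime ρ T) :=
    (hf.continuousOn_derivWithin (uniqueDiffOn_Icc (by linarith)) (by simp)).comp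
      (continuous_snd.comp continuous_snd).continuousOn fun _ hq => hq.2.2
  have h2 := continuousOn_warping (T := T) hf
  exact (hflow.cont_two 0 0).add
    (h2.mul ((h1.mul (hflow.cont_one 1)).add (h2.mul (hflow.cont_two 1 1))))

omit hρ hf in
theorem continuousOn_exp : ContinuousOn (fun q => Real.exp (-2 * W q)) (spaceTime ρ T) :=
  (continuousOn_const.mul hflow.cont).rexp

omit hρ hf in
theorem dirDeriv_time_eq : ∀ q ∈ posSpaceTime ρ T, dirDeriv (posSpaceTime ρ T) timeVec W q
    = Real.exp (-2 * W q) * flatLaplacian ρ f (fun p => W (q.1, p)) q.2 :=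
  fun q hq => (hasDerivAt_time hflow.smooth hq).unique (hflow.evolution q hq)

theorem dirDeriv_evolution : ∀ q ∈ posSpaceTime ρ T, dirDeriv (posSpaceTime ρ T) timeVec W q
    = Real.exp (-2 * W q) *
      (dirDeriv (posSpaceTime ρ T) (spaceVec 0) (dirDeriv (posSpaceTime ρ T) (spaceVec 0) W) q
        + scaledDeriv (posSpaceTime ρ T) (spaceVec 1) (warping f)
          (scaledDeriv (posSpaceTime ρ T) (spaceVec 1) (warping f) W) q) :=
  fun q hq => by rw [hflow.dirDeriv_time_eq q hq, flatLaplacian_slice hρ hf hflow.smooth hq]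

omit hf in
theorem scaledDeriv_boundary : ∀ q ∈ posSpaceTime ρ T, q.2 ∈ bdry ρ →
    scaledDeriv (posSpaceTime ρ T) (spaceVec 1) (warping f) W q = c q.2.2 * Real.exp (W q) :=
  fun q hq hb => by
    rw [← hflow.boundary q hq hb, scaledDeriv, pd_slice hρ hflow.smooth 1 hq, warping]

/-- The boundary condition for the linearised equation: time direction. -/
theorem scaledDeriv_boundary_time {q : ℝ × (ℝ × ℝ)} (hq : q ∈ posSpaceTime ρ T)
    (hb : q.2 ∈ bdry ρ) :
    scaledDeriv (posSpaceTime ρ T) (spaceVec 1) (warping f)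
      (dirDeriv (posSpaceTime ρ T) timeVec W) q
      = c q.2.2 * Real.exp (W q) * dirDeriv (posSpaceTime ρ T) timeVec W q := by
  have hS := uniqueDiffOn_posSpaceTime (T := T) hρ
  have hF := contDiffOn_warping (T := T) hf
  -- As `f` does not depend on time, `D` commutes with `∂_t`, and the boundary condition, valid for
  -- all positive times, can be differentiated in `t`.
  rw [← dirDeriv_scaledDeriv hS (posSpaceTime_subset_closure hρ) hF hflow.smooth
    (dirDeriv_time_warping hf) hq]
  refine (hasDerivAt_time (contDiffOn_scaledDeriv hS hF hflow.smooth _) hq).unique ?_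
  have h1 := ((hasDerivAt_time hflow.smooth hq).exp).const_mul (c q.2.2)
  rw [mul_assoc]
  refine h1.congr_of_eventuallyEq ?_
  filter_upwards [(isOpen_positive_times T).mem_nhds ⟨hq.1, hq.2.1⟩] with s hs
  exact hflow.scaledDeriv_boundary hρ (s, q.2) ⟨hs.1, hs.2, hq.2.2⟩ hb

/-- The boundary condition for the linearised equation: angular direction. -/
theorem scaledDeriv_boundary_angle {q : ℝ × (ℝ × ℝ)} (hq : q ∈ posSpaceTime ρ T)
    (hb : q.2 ∈ bdry ρ) :
    scaledDeriv (posSpaceTime ρ T) (spaceVec 1) (warping f)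
      (dirDeriv (posSpaceTime ρ T) (spaceVec 0) W) q
      = c q.2.2 * Real.exp (W q) * dirDeriv (posSpaceTime ρ T) (spaceVec 0) W q := by
  have hS := uniqueDiffOn_posSpaceTime (T := T) hρ
  have hF := contDiffOn_warping (T := T) hf
  rw [← dirDeriv_scaledDeriv hS (posSpaceTime_subset_closure hρ) hF hflow.smooth
    (dirDeriv_angle_warping hρ hf) hq]
  refine (hasDerivAt_angle hρ (contDiffOn_scaledDeriv hS hF hflow.smooth _) hq).unique ?_
  have h1 := ((hasDerivAt_angle hρ hflow.smooth hq).exp).const_mul (c q.2.2)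
  rw [mul_assoc]
  refine h1.congr_of_eventuallyEq (Filter.Eventually.of_forall fun x => ?_)
  exact hflow.scaledDeriv_boundary hρ (q.1, (x, q.2.2))
    (mem_posSpaceTime_of_mem hq rfl hq.2.2) hb

/-- The maximum principle for the linearised equation. -/
theorem linearised_nonpos (hf_pos : ∀ σ ∈ Set.Icc (-ρ) ρ, 0 < f σ) (hcr : c ρ ≤ 0)
    (hcl : 0 ≤ c (-ρ)) {H K : ℝ × (ℝ × ℝ) → ℝ}
    (hK : ContDiffOn ℝ ∞ K (posSpaceTime ρ T)) (hHK : Set.EqOn H K (posSpaceTime ρ T))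
    (hcont : ContinuousOn H (spaceTime ρ T))
    (hper : ∀ q ∈ spaceTime ρ T, H (q.1, (q.2.1 + 2 * Real.pi, q.2.2)) = H q)
    (heq : ∀ q ∈ posSpaceTime ρ T, dirDeriv (posSpaceTime ρ T) timeVec K q =
      Real.exp (-2 * W q) *
        (dirDeriv (posSpaceTime ρ T) (spaceVec 0) (dirDeriv (posSpaceTime ρ T) (spaceVec 0) K) q
          + scaledDeriv (posSpaceTime ρ T) (spaceVec 1) (warping f)
            (scaledDeriv (posSpaceTime ρ T) (spaceVec 1) (warping f) K) q)
      - 2 * dirDeriv (posSpaceTime ρ T) timeVec W q * K q)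
    (hbd : ∀ q ∈ posSpaceTime ρ T, q.2 ∈ bdry ρ →
      scaledDeriv (posSpaceTime ρ T) (spaceVec 1) (warping f) K q = c q.2.2 * Real.exp (W q) * K q)
    (hinit : ∀ p ∈ strip ρ, H (0, p) ≤ 0) : ∀ q ∈ spaceTime ρ T, H q ≤ 0 := by
  -- The coefficient `-2 W_t` is written through the evolution equation, since that expression is
  -- continuous down to time zero.
  refine parabolic_nonpos_of_scaledDeriv (a := fun q => Real.exp (-2 * W q)) (b := fun _ => 0)
    (e := fun q => -2 * (Real.exp (-2 * W q) * flatLaplacian ρ f (fun p => W (q.1, p)) q.2))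
    hρ hf hf_pos hK hHK hcont hper hflow.continuousOn_exp continuousOn_const
    (continuousOn_const.mul (hflow.continuousOn_exp.mul (hflow.continuousOn_flatLaplacian hρ hf)))
    (fun q _ => (Real.exp_pos _).le) ?_ ?_ ?_ hinit
  · intro q hq
    rw [heq q hq, hflow.dirDeriv_time_eq q hq]
    ring
  · intro q hq h hpos
    rw [hbd q hq (Or.inr h), h]
    have := mul_pos (Real.exp_pos (W q)) hpos
    nlinarith
  · intro q hq h hpos
    rw [hbd q hq (Or.inl h), h]
    have := mul_pos (Real.exp_pos (W q)) hpos
    nlinarith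

omit hρ hf in
theorem slice_periodic {q : ℝ × (ℝ × ℝ)} (hq : q ∈ spaceTime ρ T) :
    ∀ p ∈ strip ρ, W (q.1, (p.1 + 2 * Real.pi, p.2)) = W (q.1, p) :=
  fun p hp => hflow.periodic (q.1, p) ⟨hq.1, hq.2.1, hp⟩

end IsConformalFlow

end ConformalFlow

theorem scaledDeriv_const_mul {E : Type*} [NormedAddCommGroup E] [NormedSpace ℝ E] {S : Set E}
    {F H : E → ℝ} {y q : E} (hS : UniqueDiffOn ℝ S) (hH : ContDiffOn ℝ ∞ H S) (r : ℝ)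
    (hq : q ∈ S) : scaledDeriv S y F (fun x => r * H x) q = r * scaledDeriv S y F H q := by
  unfold scaledDeriv
  rw [dirDeriv_const_mul hS hH r hq]
  ring

/-! ### A priori estimates: symmetry, sign of the curvature, gradient quantity. -/

namespace IsConformalFlow

variable {ρ : ℝ} {f : ℝ → ℝ} {T : EReal} {c : ℝ → ℝ} {W : ℝ × (ℝ × ℝ) → ℝ}
variable (hρ : 0 < ρ) (hf : ContDiffOn ℝ ∞ f (Set.Icc (-ρ) ρ)) (hflow : IsConformalFlow ρ f T c W)
  (hf_pos : ∀ σ ∈ Set.Icc (-ρ) ρ, 0 < f σ) (hcr : c ρ ≤ 0) (hcl : 0 ≤ c (-ρ))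

include hρ hf hflow hf_pos hcr hcl

/-- The rotational symmetry of the initial metric is preserved. -/
theorem pd_angle_eq_zero :
    ∀ q ∈ spaceTime ρ T, pd ρ 0 (fun p => W (q.1, p)) q.2 = 0 := by
  have hS := uniqueDiffOn_posSpaceTime (T := T) hρ
  have hF := contDiffOn_warping (T := T) hf
  have hK := contDiffOn_dirDeriv hS hflow.smooth (spaceVec 0)
  have hlin := fun q (hq : q ∈ posSpaceTime ρ T) =>
    linearised_equation hS (posSpaceTime_subset_closure hρ) hF hflow.smooth
    (dirDeriv_angle_warping hρ hf) (hflow.dirDeriv_evolution hρ hf) hq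
  have hzero : ∀ p ∈ strip ρ, pd ρ 0 (fun p => W (0, p)) p = 0 := fun p hp => by
    rw [pd_congr (k := fun p => Real.log (f p.2)) hflow.initial 0 hp]
    exact pd_zero_of_snd fun y => Real.log (f y)
  -- The problem for `W_θ` is linear with zero initial value, so the one-sided principle applies to
  -- `W_θ` and to `-W_θ`.
  have key : ∀ r : ℝ, ∀ q ∈ spaceTime ρ T, r * pd ρ 0 (fun p => W (q.1, p)) q.2 ≤ 0 := by
    intro r
    refine hflow.linearised_nonpos hρ hf hf_pos hcr hcl
      (K := fun q => r * dirDeriv (posSpaceTime ρ T) (spaceVec 0) W q) (contDiffOn_const.mul hK)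
      (fun q hq => by simp only [pd_slice hρ hflow.smooth 0 hq])
      (continuousOn_const.mul (hflow.cont_one 0)) ?_ ?_ ?_ ?_
    · intro q hq
      simp only
      rw [pd_periodic (hflow.slice_periodic hq) 0 hq.2.2]
    · intro q hq
      rw [dirDeriv_const_mul hS hK r hq, hlin q hq,
        dirDeriv_congr (fun z hz => dirDeriv_const_mul hS hK r hz) hq,
        dirDeriv_const_mul hS (contDiffOn_dirDeriv hS hK _) r hq,
        scaledDeriv_congr (fun z hz => scaledDeriv_const_mul hS hK r hz) hq,
        scaledDeriv_const_mul hS (contDiffOn_scaledDeriv hS hF hK _) r hq]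
      ring
    · intro q hq hb
      rw [scaledDeriv_const_mul hS hK r hq, hflow.scaledDeriv_boundary_angle hρ hf hq hb]
      ring
    · intro p hp
      simp only [hzero p hp, mul_zero, le_refl]
  intro q hq
  have h1 := key 1 q hq
  have h2 := key (-1) q hq
  linarith

/-- Nonnegative curvature is preserved. -/
theorem flatLaplacian_nonpos
    (hcurv : ∀ p ∈ strip ρ, flatLaplacian ρ f (fun p => Real.log (f p.2)) p ≤ 0) :
    ∀ q ∈ spaceTime ρ T, flatLaplacian ρ f (fun p => W (q.1, p)) q.2 ≤ 0 := by
  have hS := uniqueDiffOn_posSpaceTime (T := T) hρ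
  have hF := contDiffOn_warping (T := T) hf
  have key : ∀ q ∈ spaceTime ρ T,
      Real.exp (-2 * W q) * flatLaplacian ρ f (fun p => W (q.1, p)) q.2 ≤ 0 := by
    refine hflow.linearised_nonpos hρ hf hf_pos hcr hcl
      (K := dirDeriv (posSpaceTime ρ T) timeVec W) (contDiffOn_dirDeriv hS hflow.smooth _)
      (fun q hq => (hflow.dirDeriv_time_eq q hq).symm)
      (hflow.continuousOn_exp.mul (hflow.continuousOn_flatLaplacian hρ hf)) ?_ ?_ ?_ ?_
    · intro q hq
      simp only
      rw [flatLaplacian_periodic (hflow.slice_periodic hq) hq.2.2, hflow.periodic q hq]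
    · intro q hq
      exact linearised_equation hS (posSpaceTime_subset_closure hρ) hF hflow.smooth
        (dirDeriv_time_warping hf) (hflow.dirDeriv_evolution hρ hf) hq
    · intro q hq hb
      exact hflow.scaledDeriv_boundary_time hρ hf hq hb
    · intro p hp
      simp only
      rw [flatLaplacian_congr hflow.initial hp]
      exact mul_nonpos_of_nonneg_of_nonpos (Real.exp_pos _).le (hcurv p hp)
  intro q hq
  exact nonpos_of_mul_nonpos_right (key q hq) (Real.exp_pos _)

/-- The scale invariant curvature estimate. -/
theorem gradient_quantity_le
    (hcurv : ∀ p ∈ strip ρ, flatLaplacian ρ f (fun p => Real.log (f p.2)) p ≤ 0) {M : ℝ}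
    (hM : ∀ p ∈ strip ρ, (f p.2 * pd ρ 1 (fun p => Real.log (f p.2)) p) ^ 2
      - flatLaplacian ρ f (fun p => Real.log (f p.2)) p ≤ M) :
    ∀ q ∈ spaceTime ρ T, (f q.2.2 * pd ρ 1 (fun p => W (q.1, p)) q.2) ^ 2
      - flatLaplacian ρ f (fun p => W (q.1, p)) q.2 ≤ M := by
  have hS := uniqueDiffOn_posSpaceTime (T := T) hρ
  have hF := contDiffOn_warping (T := T) hf
  have hP := contDiffOn_scaledDeriv hS hF hflow.smooth (spaceVec 1)
  have hDP := contDiffOn_scaledDeriv hS hF hP (spaceVec 1)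
  have hWx : ∀ q ∈ posSpaceTime ρ T, dirDeriv (posSpaceTime ρ T) (spaceVec 0) W q = 0 :=
    fun q hq => by
      rw [← pd_slice hρ hflow.smooth 0 hq]
      exact hflow.pd_angle_eq_zero hρ hf hf_pos hcr hcl q (posSpaceTime_subset hq)
  have hWt : ∀ q ∈ posSpaceTime ρ T, dirDeriv (posSpaceTime ρ T) timeVec W q ≤ 0 :=
    fun q hq => by
      rw [hflow.dirDeriv_time_eq q hq]
      exact mul_nonpos_of_nonneg_of_nonpos (Real.exp_pos _).le
        (hflow.flatLaplacian_nonpos hρ hf hf_pos hcr hcl hcurv q (posSpaceTime_subset hq))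
  obtain ⟨Z, hZ⟩ : ∃ Z : ℝ × (ℝ × ℝ) → ℝ, Z = fun q =>
      scaledDeriv (posSpaceTime ρ T) (spaceVec 1) (warping f) W q
        * scaledDeriv (posSpaceTime ρ T) (spaceVec 1) (warping f) W q
      - scaledDeriv (posSpaceTime ρ T) (spaceVec 1) (warping f)
        (scaledDeriv (posSpaceTime ρ T) (spaceVec 1) (warping f) W) q := ⟨_, rfl⟩
  have hZs : ContDiffOn ℝ ∞ Z (posSpaceTime ρ T) := by
    rw [hZ]
    exact (hP.mul hP).sub hDP
  have heqs := fun q (hq : q ∈ posSpaceTime ρ T) =>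
    gradient_quantity_equations hS (posSpaceTime_subset_closure hρ) hF hflow.smooth
      (dirDeriv_time_warping hf) (dirDeriv_angle_warping hρ hf) (hflow.dirDeriv_evolution hρ hf)
      hWx hZ hq
  have hd : ∀ v, ∀ q ∈ posSpaceTime ρ T, dirDeriv (posSpaceTime ρ T) v (fun q => Z q - M) q
      = dirDeriv (posSpaceTime ρ T) v Z q := fun v q hq => by
    rw [dirDeriv_sub hS hZs contDiffOn_const hq, dirDeriv_const, sub_zero]
  have hD : ∀ q ∈ posSpaceTime ρ T,
      scaledDeriv (posSpaceTime ρ T) (spaceVec 1) (warping f) (fun q => Z q - M) q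
        = scaledDeriv (posSpaceTime ρ T) (spaceVec 1) (warping f) Z q := fun q hq => by
    rw [scaledDeriv, hd _ q hq, scaledDeriv]
  -- On the boundary `DZ = c e^{3W} (-W_t)`, which has the sign of `c` because `W_t ≤ 0`:
  -- nonpositive at `ρ` and nonnegative at `-ρ`.
  have hbdry : ∀ q ∈ posSpaceTime ρ T, q.2 ∈ bdry ρ →
      scaledDeriv (posSpaceTime ρ T) (spaceVec 1) (warping f) (fun q => Z q - M) q
        = Real.exp (2 * W q) * Real.exp (W q)
          * (c q.2.2 * -dirDeriv (posSpaceTime ρ T) timeVec W q) := fun q hq hb => by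
    rw [hD q hq, (heqs q hq).2.1, hflow.scaledDeriv_boundary_time hρ hf hq hb]
    ring
  have key := parabolic_nonpos_of_scaledDeriv
    (H := fun q => (f q.2.2 * pd ρ 1 (fun p => W (q.1, p)) q.2) ^ 2
      - flatLaplacian ρ f (fun p => W (q.1, p)) q.2 - M) (K := fun q => Z q - M)
    (a := fun q => Real.exp (-2 * W q))
    (b := fun q => -4 * Real.exp (-2 * W q) * (f q.2.2 * pd ρ 1 (fun p => W (q.1, p)) q.2))
    (e := fun _ => 0) hρ hf hf_pos (hZs.sub contDiffOn_const) ?_ ?_ ?_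
    hflow.continuousOn_exp ?_ continuousOn_const (fun q _ => (Real.exp_pos _).le) ?_ ?_ ?_ ?_
  · intro q hq
    have := key q hq
    linarith
  · intro q hq
    simp only
    rw [flatLaplacian_slice hρ hf hflow.smooth hq, dirDeriv_eq_zero hWx hq, hZ,
      pd_slice hρ hflow.smooth 1 hq]
    simp only [scaledDeriv, warping]
    ring
  · exact ((((continuousOn_warping hf).mul (hflow.cont_one 1)).pow 2).sub
      (hflow.continuousOn_flatLaplacian hρ hf)).sub continuousOn_const
  · intro q hq
    simp only
    rw [flatLaplacian_periodic (hflow.slice_periodic hq) hq.2.2,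
      pd_periodic (hflow.slice_periodic hq) 1 hq.2.2]
  · exact (continuousOn_const.mul hflow.continuousOn_exp).mul
      ((continuousOn_warping hf).mul (hflow.cont_one 1))
  · intro q hq
    obtain ⟨h1, -, h3⟩ := heqs q hq
    rw [hd _ q hq, hD q hq, scaledDeriv_congr hD hq, dirDeriv_congr (hd _) hq, h1, h3,
      pd_slice hρ hflow.smooth 1 hq,
      show scaledDeriv (posSpaceTime ρ T) (spaceVec 1) (warping f) W q
        = f q.2.2 * dirDeriv (posSpaceTime ρ T) (spaceVec 1) W q from rfl]
    ring
  · intro q hq h _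
    rw [hbdry q hq (Or.inr h), h]
    have h1 := hWt q hq
    exact mul_nonpos_of_nonneg_of_nonpos (by positivity)
      (mul_nonpos_of_nonpos_of_nonneg hcr (by linarith))
  · intro q hq h _
    rw [hbdry q hq (Or.inl h), h]
    have h1 := hWt q hq
    exact mul_nonneg (by positivity) (mul_nonneg hcl (by linarith))
  · intro p hp
    have h1 := hM p hp
    simp only
    rw [flatLaplacian_congr hflow.initial hp, pd_congr hflow.initial 1 hp]
    linarith

end IsConformalFlow

/-! ### From the tensor flow to the scalar conformal flow. -/

section RicciFlowConformal

variable {ρ : ℝ} {f : ℝ → ℝ} {T : EReal} {g : ℝ → TensorField}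

theorem IsRicciFlow.zero_zero_pos {g₀ : TensorField} (hflow : IsRicciFlow ρ g₀ T g)
    {q : ℝ × (ℝ × ℝ)} (hq : q ∈ spaceTime ρ T) : 0 < g q.1 q.2 0 0 :=
  ((hflow.metric q.1 hq.1 hq.2.1).posDef q.2 hq.2.2).diag_pos

/-- The flow stays in a conformal class. -/
theorem IsRicciFlow.ratio_eq {g₀ : TensorField} (hflow : IsRicciFlow ρ g₀ T g)
    {q : ℝ × (ℝ × ℝ)} (hq : q ∈ spaceTime ρ T) (a b : Fin 2) :
    g q.1 q.2 a b / g q.1 q.2 0 0 = g₀ q.2 a b / g₀ q.2 0 0 := by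
  rw [← hflow.initial q.2 hq.2.2]
  rcases hq.1.eq_or_lt with h0 | h0
  · rw [← h0]
  have hmem : ∀ s ∈ Set.Icc 0 q.1, (s, q.2) ∈ spaceTime ρ T := fun s hs =>
    ⟨hs.1, lt_of_le_of_lt (EReal.coe_le_coe_iff.2 hs.2) hq.2.1, hq.2.2⟩
  have hc : ∀ a b, ContinuousOn (fun s => g s q.2 a b) (Set.Icc 0 q.1) := fun a b =>
    (hflow.cont a b).comp (Continuous.prodMk_left q.2).continuousOn hmem
  -- All components satisfy the same linear equation with factor `-R`, so their ratios have zero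
  -- derivative. The mean value theorem needs only continuity at time zero.
  obtain ⟨s, hs, h⟩ := exists_hasDerivAt_eq_slope (fun s => g s q.2 a b / g s q.2 0 0)
    (fun _ => 0) h0
    ((hc a b).div (hc 0 0) fun s hs => (hflow.zero_zero_pos (hmem s hs)).ne') (by
      intro s hs
      have h1 := hmem s (Set.Ioo_subset_Icc_self hs)
      have hpos := (hflow.zero_zero_pos h1).ne'
      refine ((hflow.evolution s hs.1 h1.2.1 q.2 hq.2.2 a b).div
        (hflow.evolution s hs.1 h1.2.1 q.2 hq.2.2 0 0) hpos).congr_deriv ?_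
      rw [div_eq_zero_iff]
      left
      ring)
  rw [eq_comm, div_eq_zero_iff] at h
  rcases h with h | h <;> linarith

/-- The logarithm of the conformal factor. -/
noncomputable def logFactor (g : ℝ → TensorField) (q : ℝ × (ℝ × ℝ)) : ℝ :=
  1 / 2 * Real.log (g q.1 q.2 0 0)

theorem IsRicciFlow.exp_logFactor {g₀ : TensorField} (hflow : IsRicciFlow ρ g₀ T g)
    {q : ℝ × (ℝ × ℝ)} (hq : q ∈ spaceTime ρ T) :
    Real.exp (2 * logFactor g q) = g q.1 q.2 0 0 := by
  rw [logFactor, ← mul_assoc]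
  norm_num
  exact Real.exp_log (hflow.zero_zero_pos hq)

theorem IsRicciFlow.hasConformalFactor (hf_pos : ∀ σ ∈ Set.Icc (-ρ) ρ, 0 < f σ)
    (hflow : IsRicciFlow ρ (warpedMetric f) T g) {t : ℝ} (ht : 0 ≤ t) (htT : (t : EReal) < T) :
    HasConformalFactor ρ f (g t) (fun p => logFactor g (t, p)) := by
  intro p hp
  have hq : (t, p) ∈ spaceTime ρ T := ⟨ht, htT, hp⟩
  have hfp := hf_pos p.2 hp
  have hpos := hflow.zero_zero_pos hq
  have hr := fun a b => (div_eq_iff hpos.ne').1 (hflow.ratio_eq hq a b)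
  simp only [hflow.exp_logFactor hq]
  simp only at hr hpos
  ext a b
  fin_cases a <;> fin_cases b
  · simp
  · simpa [warpedMetric] using hr 0 1
  · simpa [warpedMetric] using hr 1 0
  · simp only [Fin.mk_one, Matrix.of_apply, Matrix.cons_val', Matrix.cons_val_one,
      Matrix.cons_val_fin_one]
    rw [hr 1 1]
    simp [warpedMetric]
    field_simp

theorem IsRicciFlow.contDiffOn_logFactor_slice {g₀ : TensorField} (hflow : IsRicciFlow ρ g₀ T g)
    {t : ℝ} (ht : 0 ≤ t) (htT : (t : EReal) < T) :
    ContDiffOn ℝ ∞ (fun p => logFactor g (t, p)) (strip ρ) :=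
  contDiffOn_const.mul (((hflow.metric t ht htT).smooth 0 0).log fun _ hp =>
    (hflow.zero_zero_pos (q := (t, _)) ⟨ht, htT, hp⟩).ne')

theorem IsRicciFlow.pd_logFactor (hρ : 0 < ρ) (hf_pos : ∀ σ ∈ Set.Icc (-ρ) ρ, 0 < f σ)
    (hflow : IsRicciFlow ρ (warpedMetric f) T g) (i : Fin 2) {q : ℝ × (ℝ × ℝ)}
    (hq : q ∈ spaceTime ρ T) :
    pd ρ i (fun p => logFactor g (q.1, p)) q.2
      = pd ρ i (fun p => g q.1 p 0 0) q.2 / (2 * g q.1 q.2 0 0) := by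
  rw [(hflow.hasConformalFactor hf_pos hq.1 hq.2.1).pd_zero_zero hρ
    (hflow.contDiffOn_logFactor_slice hq.1 hq.2.1) i hq.2.2, hflow.exp_logFactor hq]
  have := (hflow.zero_zero_pos hq).ne'
  field_simp

/-- Expressing the second derivatives through those of `g₀₀` transfers the assumed continuity at
time zero to the logarithm. -/
theorem IsRicciFlow.pd_pd_logFactor (hρ : 0 < ρ) (hf_pos : ∀ σ ∈ Set.Icc (-ρ) ρ, 0 < f σ)
    (hflow : IsRicciFlow ρ (warpedMetric f) T g) (i j : Fin 2) {q : ℝ × (ℝ × ℝ)}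
    (hq : q ∈ spaceTime ρ T) :
    pd ρ i (pd ρ j (fun p => logFactor g (q.1, p))) q.2
      = pd ρ i (pd ρ j (fun p => g q.1 p 0 0)) q.2 / (2 * g q.1 q.2 0 0)
        - pd ρ i (fun p => g q.1 p 0 0) q.2 / g q.1 q.2 0 0
          * pd ρ j (fun p => logFactor g (q.1, p)) q.2 := by
  have hpos := (hflow.zero_zero_pos hq).ne'
  have hG := (hflow.metric q.1 hq.1 hq.2.1).smooth 0 0
  have hwj := contDiffOn_pd hρ (hflow.contDiffOn_logFactor_slice hq.1 hq.2.1) j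
  have h1 : Set.EqOn (pd ρ j (fun p => g q.1 p 0 0))
      (fun p => 2 * (g q.1 p 0 0 * pd ρ j (fun p => logFactor g (q.1, p)) p)) (strip ρ) := by
    intro p hp
    have hq' : (q.1, p) ∈ spaceTime ρ T := ⟨hq.1, hq.2.1, hp⟩
    have h2 := hflow.pd_logFactor hρ hf_pos j hq'
    have h3 := (hflow.zero_zero_pos hq').ne'
    simp only at h2 h3
    simp only [h2]
    field_simp
  rw [pd_congr h1 i hq.2.2, pd_const_mul hρ (hG.mul hwj) _ hq.2.2, pd_mul hρ hG hwj hq.2.2]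
  field_simp
  ring

theorem IsRicciFlow.isConformalFlow (hρ : 0 < ρ) (hf : ContDiffOn ℝ ∞ f (Set.Icc (-ρ) ρ))
    (hf_pos : ∀ σ ∈ Set.Icc (-ρ) ρ, 0 < f σ) (hflow : IsRicciFlow ρ (warpedMetric f) T g) :
    IsConformalFlow ρ f T (fun σ => derivWithin f (Set.Icc (-ρ) ρ) σ / f σ) (logFactor g) := by
  have hw := fun {q : ℝ × (ℝ × ℝ)} (hq : q ∈ spaceTime ρ T) =>
    hflow.contDiffOn_logFactor_slice hq.1 hq.2.1
  have hg := fun {q : ℝ × (ℝ × ℝ)} (hq : q ∈ spaceTime ρ T) =>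
    hflow.hasConformalFactor hf_pos hq.1 hq.2.1
  have hne : ∀ q ∈ spaceTime ρ T, g q.1 q.2 0 0 ≠ 0 := fun q hq => (hflow.zero_zero_pos hq).ne'
  have hone : ∀ i, ContinuousOn (fun q : ℝ × (ℝ × ℝ) => pd ρ i (fun p => logFactor g (q.1, p)) q.2)
      (spaceTime ρ T) := fun i =>
    ((hflow.cont_one 0 0 i).div (continuousOn_const.mul (hflow.cont 0 0)) fun q hq =>
      mul_ne_zero two_ne_zero (hne q hq)).congr fun q hq => hflow.pd_logFactor hρ hf_pos i hq
  have htwo : ∀ i j, ContinuousOn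
      (fun q : ℝ × (ℝ × ℝ) => pd ρ i (pd ρ j (fun p => logFactor g (q.1, p))) q.2)
      (spaceTime ρ T) := fun i j =>
    (((hflow.cont_two 0 0 i j).div (continuousOn_const.mul (hflow.cont 0 0)) fun q hq =>
      mul_ne_zero two_ne_zero (hne q hq)).sub
      (((hflow.cont_one 0 0 i).div (hflow.cont 0 0) hne).mul (hone j))).congr
      fun q hq => hflow.pd_pd_logFactor hρ hf_pos i j hq
  refine ⟨?_, ?_, hone, htwo, ?_, ?_, ?_, ?_⟩
  · exact contDiffOn_const.mul ((hflow.smooth 0 0).log fun q hq => hne q (posSpaceTime_subset hq))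
  · exact continuousOn_const.mul ((hflow.cont 0 0).log hne)
  · intro q hq
    simp only [logFactor]
    rw [(hflow.metric q.1 hq.1 hq.2.1).periodic q.2 hq.2.2]
  · intro q hq
    have hq' := posSpaceTime_subset hq
    have hpos := hflow.zero_zero_pos hq'
    have h := ((hflow.evolution q.1 hq.1 hq.2.1 q.2 hq.2.2 0 0).log hpos.ne').const_mul (1 / 2)
    refine h.congr_deriv ?_
    rw [(hg hq').scalarCurv_eq hρ hf hf_pos (hw hq') hq.2.2]
    simp only [neg_mul]
    field_simp
  · intro q hq hb
    have hq' := posSpaceTime_subset hq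
    have hfp := hf_pos q.2.2 hq.2.2
    have h := hflow.boundary q.1 hq.1 hq.2.1 q.2 hb
    rw [(hg hq').geodesicCurv_eq hρ hf hf_pos (hw hq') hq.2.2,
      (hasConformalFactor_warpedMetric hf_pos).geodesicCurv_eq hρ hf hf_pos
        (contDiffOn_log_warping hf hf_pos) hq.2.2, pd_one_log_warping hρ hf hf_pos hq.2.2,
      Real.exp_neg, Real.exp_neg, Real.exp_log hfp] at h
    -- The orientation sign occurs on both sides of the boundary condition and cancels, so `c =
    -- f'/f` serves at both ends.
    have hs : Real.sign q.2.2 ≠ 0 := by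
      rw [Ne, Real.sign_eq_zero_iff]
      rcases hb with hb | hb <;> rw [hb] <;> linarith
    have he := (Real.exp_pos (logFactor g q)).ne'
    change Real.sign q.2.2 * _ * (Real.exp (logFactor g q))⁻¹ = _ at h
    field_simp at h ⊢
    exact h
  · intro p hp
    have hfp := hf_pos p.2 hp
    simp only [logFactor, hflow.initial p hp, warpedMetric]
    simp

end RicciFlowConformal

/-! ### Signs at the boundary, oscillation and area. -/

section Warping

variable {ρ : ℝ} {f : ℝ → ℝ}

/-- By concavity `f'` is nonincreasing, and by symmetry it takes opposite values at the two ends;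
hence `f'(ρ) ≤ f'(-ρ) = -f'(ρ)`. -/
theorem derivWithin_warping_boundary (hρ : 0 < ρ) (hf : ContDiffOn ℝ ∞ f (Set.Icc (-ρ) ρ))
    (hsymm : ∀ σ ∈ Set.Icc (-ρ) ρ, f (-σ) = f σ)
    (hconc : ∀ σ ∈ Set.Icc (-ρ) ρ,
      derivWithin (derivWithin f (Set.Icc (-ρ) ρ)) (Set.Icc (-ρ) ρ) σ ≤ 0) :
    derivWithin f (Set.Icc (-ρ) ρ) ρ ≤ 0 ∧ 0 ≤ derivWithin f (Set.Icc (-ρ) ρ) (-ρ) := by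
  have hu : UniqueDiffOn ℝ (Set.Icc (-ρ) ρ) := uniqueDiffOn_Icc (by linarith)
  have hr : ρ ∈ Set.Icc (-ρ) ρ := ⟨by linarith, le_rfl⟩
  have hl : -ρ ∈ Set.Icc (-ρ) ρ := ⟨le_rfl, by linarith⟩
  have hf' : ContDiffOn ℝ ∞ (derivWithin f (Set.Icc (-ρ) ρ)) (Set.Icc (-ρ) ρ) :=
    hf.derivWithin hu (by simp)
  have hanti : AntitoneOn (derivWithin f (Set.Icc (-ρ) ρ)) (Set.Icc (-ρ) ρ) := by
    refine antitoneOn_of_deriv_nonpos (convex_Icc _ _) hf'.continuousOn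
      ((hf'.differentiableOn (by simp)).mono interior_subset) fun σ hσ => ?_
    rw [interior_Icc] at hσ
    rw [← derivWithin_of_mem_nhds (Icc_mem_nhds hσ.1 hσ.2)]
    exact hconc σ (Set.Ioo_subset_Icc_self hσ)
  have hodd : derivWithin f (Set.Icc (-ρ) ρ) ρ = -derivWithin f (Set.Icc (-ρ) ρ) (-ρ) := by
    have h1 : HasDerivWithinAt f (derivWithin f (Set.Icc (-ρ) ρ) (-ρ)) (Set.Icc (-ρ) ρ) (-ρ) :=
      (hf.differentiableOn (by simp) _ hl).hasDerivWithinAt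
    have h2 := h1.comp_of_eq ρ (hasDerivWithinAt_neg ρ (Set.Icc (-ρ) ρ))
      (fun σ hσ => ⟨by linarith [hσ.2], by linarith [hσ.1]⟩) rfl
    have h3 : HasDerivWithinAt f _ (Set.Icc (-ρ) ρ) ρ :=
      h2.congr (fun σ hσ => (hsymm σ hσ).symm) (hsymm ρ hr).symm
    rw [h3.derivWithin (hu ρ hr)]
    ring
  have := hanti hl hr hl.2
  constructor <;> linarith

theorem flatLaplacian_add_const (w : ℝ × ℝ → ℝ) (k : ℝ) (p : ℝ × ℝ) :
    flatLaplacian ρ f (fun p => w p + k) p = flatLaplacian ρ f w p := by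
  have h : ∀ i, pd ρ i (fun p => w p + k) = pd ρ i w := by
    intro i
    funext q
    unfold pd
    split_ifs
    · exact deriv_add_const k
    · exact derivWithin_add_const k
  unfold flatLaplacian
  rw [h, h]

/-- A rotationally symmetric function with bounded height derivative has bounded oscillation. -/
theorem le_add_of_pd_bound (hρ : 0 < ρ) {w : ℝ × ℝ → ℝ} (hw : ContDiffOn ℝ ∞ w (strip ρ))
    (h0 : ∀ p ∈ strip ρ, pd ρ 0 w p = 0) {B : ℝ} (hB : ∀ p ∈ strip ρ, |pd ρ 1 w p| ≤ B)
    {p q : ℝ × ℝ} (hp : p ∈ strip ρ) (hq : q ∈ strip ρ) : w q ≤ w p + B * (2 * ρ) := by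
  have hrot : w q = w (p.1, q.2) := by
    refine is_const_of_deriv_eq_zero (f := fun x => w (x, q.2)) (fun x => ?_) (fun x => ?_) q.1 p.1
    · exact (hasDerivAt_dirDeriv_strip hw (p := (x, q.2)) hq).differentiableAt
    · have := h0 (x, q.2) hq
      simpa [pd] using this
  have hder : ∀ y ∈ Set.Icc (-ρ) ρ, HasDerivWithinAt (fun y => w (p.1, y)) (pd ρ 1 w (p.1, y))
      (Set.Icc (-ρ) ρ) y := fun y hy => by
    rw [pd_eq_dirDeriv hρ hw 1 (p := (p.1, y)) hy]
    exact hasDerivWithinAt_dirDeriv_strip hw (p := (p.1, y)) hy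
  have hmvt := (convex_Icc (-ρ) ρ).norm_image_sub_le_of_norm_hasDerivWithin_le hder
    (fun y hy => hB (p.1, y) hy) hp hq
  have hB0 : 0 ≤ B := (abs_nonneg _).trans (hB p hp)
  have hdist : |q.2 - p.2| ≤ 2 * ρ :=
    abs_le.2 ⟨by linarith [hp.2, hq.1], by linarith [hp.1, hq.2]⟩
  have h1 : w (p.1, q.2) - w (p.1, p.2) ≤ B * (2 * ρ) :=
    (le_abs_self _).trans (hmvt.trans (mul_le_mul_of_nonneg_left hdist hB0))
  rw [hrot]
  linarith

theorem area_le_of_hasConformalFactor (hρ : 0 < ρ) {δ : ℝ} (hδ : 0 < δ)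
    (hfδ : ∀ σ ∈ Set.Icc (-ρ) ρ, δ ≤ f σ) {g : TensorField} {w : ℝ × ℝ → ℝ}
    (hg : HasConformalFactor ρ f g w) {b : ℝ} (hb : ∀ p ∈ strip ρ, w p ≤ b) :
    area ρ g ≤ Real.exp (2 * b) / δ * (2 * ρ) * (2 * Real.pi) := by
  have hpt : ∀ p ∈ strip ρ, ‖Real.sqrt (g p).det‖ ≤ Real.exp (2 * b) / δ := fun p hp => by
    have h1 := hfδ p.2 hp
    rw [hg.det_eq (fun σ hσ => hδ.trans_le (hfδ σ hσ)) hp, Real.norm_of_nonneg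
      (div_nonneg (Real.exp_pos _).le (hδ.le.trans h1))]
    have h2 := hb p hp
    gcongr
  have hin : ∀ θ : ℝ, ‖∫ σ in (-ρ)..ρ, Real.sqrt (g (θ, σ)).det‖
      ≤ Real.exp (2 * b) / δ * (2 * ρ) := fun θ => by
    have := intervalIntegral.norm_integral_le_of_norm_le_const (a := -ρ) (b := ρ)
      (f := fun σ => Real.sqrt (g (θ, σ)).det) (C := Real.exp (2 * b) / δ) fun σ hσ => by
        rw [Set.uIoc_of_le (by linarith)] at hσ
        exact hpt (θ, σ) ⟨hσ.1.le, hσ.2⟩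
    rwa [abs_of_pos (by linarith), show ρ - -ρ = 2 * ρ by ring] at this
  have := intervalIntegral.norm_integral_le_of_norm_le_const (a := 0) (b := 2 * Real.pi)
    (f := fun θ => ∫ σ in (-ρ)..ρ, Real.sqrt (g (θ, σ)).det) fun θ _ => hin θ
  rw [sub_zero, abs_of_pos Real.two_pi_pos] at this
  exact (le_abs_self _).trans this

/-- The rescaled metric `φ g` of area one has curvature bounded in terms of bounds on the conformal
factor. -/
theorem abs_scalarCurv_le_of_area_eq_one (hρ : 0 < ρ) (hf : ContDiffOn ℝ ∞ f (Set.Icc (-ρ) ρ))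
    {δ : ℝ} (hδ : 0 < δ) (hfδ : ∀ σ ∈ Set.Icc (-ρ) ρ, δ ≤ f σ) {g : TensorField} {w : ℝ × ℝ → ℝ}
    (hw : ContDiffOn ℝ ∞ w (strip ρ)) (hg : HasConformalFactor ρ f g w) (harea : area ρ g = 1)
    {M : ℝ} (h0 : ∀ p ∈ strip ρ, pd ρ 0 w p = 0)
    (hlap : ∀ p ∈ strip ρ, flatLaplacian ρ f w p ≤ 0)
    (hM : ∀ p ∈ strip ρ, (f p.2 * pd ρ 1 w p) ^ 2 - flatLaplacian ρ f w p ≤ M)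
    {p : ℝ × ℝ} (hp : p ∈ strip ρ) :
    |scalarCurv ρ g p|
      ≤ 2 * M * (Real.exp (2 * (Real.sqrt M / δ * (2 * ρ))) / δ * (2 * ρ) * (2 * Real.pi)) := by
  have hf_pos : ∀ σ ∈ Set.Icc (-ρ) ρ, 0 < f σ := fun σ hσ => hδ.trans_le (hfδ σ hσ)
  have hB : ∀ p ∈ strip ρ, |pd ρ 1 w p| ≤ Real.sqrt M / δ := fun p hp => by
    have h1 : |f p.2 * pd ρ 1 w p| ≤ Real.sqrt M :=
      Real.abs_le_sqrt (by linarith [hM p hp, hlap p hp])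
    rw [abs_mul, abs_of_pos (hf_pos p.2 hp)] at h1
    rw [le_div_iff₀ hδ, mul_comm]
    exact (mul_le_mul_of_nonneg_right (hfδ p.2 hp) (abs_nonneg _)).trans h1
  -- The oscillation bound centred at `p` gives `w ≤ w p + b` everywhere, so unit area prevents `w
  -- p` from being very negative.
  have hA := area_le_of_hasConformalFactor hρ hδ hfδ hg
    fun q hq => le_add_of_pd_bound hρ hw h0 hB hp hq
  rw [harea] at hA
  set b := Real.sqrt M / δ * (2 * ρ)
  have hl := hlap p hp
  have hlM : -flatLaplacian ρ f w p ≤ M := by nlinarith [hM p hp, sq_nonneg (f p.2 * pd ρ 1 w p)]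
  have hM0 : 0 ≤ M := by linarith
  rw [hg.scalarCurv_eq hρ hf hf_pos hw hp, abs_of_nonneg (by
    have := Real.exp_pos (-(2 * w p)); nlinarith)]
  have hexp : Real.exp (-(2 * w p)) ≤ Real.exp (2 * b) / δ * (2 * ρ) * (2 * Real.pi) := by
    have h1 := mul_le_mul_of_nonneg_left hA (Real.exp_pos (-(2 * w p))).le
    have h2 : Real.exp (-(2 * w p)) * Real.exp (2 * (w p + b)) = Real.exp (2 * b) := by
      rw [← Real.exp_add]; ring_nf
    calc Real.exp (-(2 * w p)) = Real.exp (-(2 * w p)) * 1 := (mul_one _).symm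
      _ ≤ _ := h1
      _ = (Real.exp (-(2 * w p)) * Real.exp (2 * (w p + b))) / δ * (2 * ρ) * (2 * Real.pi) := by ring
      _ = _ := by rw [h2]
  calc -2 * Real.exp (-(2 * w p)) * flatLaplacian ρ f w p
      = 2 * (-flatLaplacian ρ f w p) * Real.exp (-(2 * w p)) := by ring
    _ ≤ _ := by gcongr

end Warping

end CylinderRicciFlow

/-! ### The curvature bound for the normalised flow. -/

open CylinderRicciFlow in
/-- Curvature bound for normalised flows from a symmetric warped metric of nonnegative curvature. -/
theorem CylinderRicciFlow.exists_scalarCurv_bound (ρ : ℝ) (hρ : 0 < ρ) (f : ℝ → ℝ)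
    (hf : ContDiffOn ℝ ∞ f (Set.Icc (-ρ) ρ))
    (hf_pos : ∀ σ ∈ Set.Icc (-ρ) ρ, 0 < f σ)
    (hf_symm : ∀ σ ∈ Set.Icc (-ρ) ρ, f (-σ) = f σ)
    (hR_nonneg : ∀ p ∈ strip ρ, 0 ≤ scalarCurv ρ (warpedMetric f) p) :
    ∃ C : ℝ, ∀ (T : EReal) (g : ℝ → TensorField),
      IsNormalisedRicciFlow ρ (warpedMetric f) T g →
      ∀ t : ℝ, 0 ≤ t → (t : EReal) < T → ∀ p ∈ strip ρ, |scalarCurv ρ (g t) p| ≤ C := by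
  have hu : UniqueDiffOn ℝ (Set.Icc (-ρ) ρ) := uniqueDiffOn_Icc (by linarith)
  have hf1 : ContDiffOn ℝ ∞ (derivWithin f (Set.Icc (-ρ) ρ)) (Set.Icc (-ρ) ρ) :=
    hf.derivWithin hu (by simp)
  have hf2 : ContDiffOn ℝ ∞ (derivWithin (derivWithin f (Set.Icc (-ρ) ρ)) (Set.Icc (-ρ) ρ))
    (Set.Icc (-ρ) ρ) := hf1.derivWithin hu (by simp)
  have hcurv : ∀ p ∈ strip ρ, flatLaplacian ρ f (fun p => Real.log (f p.2)) p ≤ 0 := by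
    intro p hp
    have h := hR_nonneg p hp
    rw [(hasConformalFactor_warpedMetric hf_pos).scalarCurv_eq hρ hf hf_pos
      (contDiffOn_log_warping hf hf_pos) hp] at h
    have := Real.exp_pos (-(2 * Real.log (f p.2)))
    by_contra! hneg
    nlinarith [mul_pos this hneg]
  have hconc : ∀ σ ∈ Set.Icc (-ρ) ρ,
      derivWithin (derivWithin f (Set.Icc (-ρ) ρ)) (Set.Icc (-ρ) ρ) σ ≤ 0 := fun σ hσ => by
    have h := hcurv (0, σ) hσ
    rw [flatLaplacian_log_warping hρ hf hf_pos (p := (0, σ)) hσ] at h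
    exact nonpos_of_mul_nonpos_right h (hf_pos σ hσ)
  obtain ⟨hr, hl⟩ := derivWithin_warping_boundary hρ hf hf_symm hconc
  have hcr : derivWithin f (Set.Icc (-ρ) ρ) ρ / f ρ ≤ 0 :=
    div_nonpos_of_nonpos_of_nonneg hr (hf_pos ρ ⟨by linarith, le_rfl⟩).le
  have hcl : 0 ≤ derivWithin f (Set.Icc (-ρ) ρ) (-ρ) / f (-ρ) :=
    div_nonneg hl (hf_pos (-ρ) ⟨le_rfl, by linarith⟩).le
  obtain ⟨σ₀, hσ₀, hmin⟩ := isCompact_Icc.exists_isMinOn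
    (⟨0, by linarith, hρ.le⟩ : (Set.Icc (-ρ) ρ).Nonempty) hf.continuousOn
  have hδ := hf_pos σ₀ hσ₀
  -- `M` bounds `f'² - f f''`, the value of `(DW)² - DDW` at `W = log f`.
  obtain ⟨M, hMb⟩ := isCompact_Icc.exists_bound_of_continuousOn
    ((hf1.continuousOn.pow 2).sub (hf.continuousOn.mul hf2.continuousOn))
  have hM : ∀ p ∈ strip ρ, (f p.2 * pd ρ 1 (fun p => Real.log (f p.2)) p) ^ 2
      - flatLaplacian ρ f (fun p => Real.log (f p.2)) p ≤ M := fun p hp => by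
    have hfp := (hf_pos p.2 hp).ne'
    rw [pd_one_log_warping hρ hf hf_pos hp, flatLaplacian_log_warping hρ hf hf_pos hp,
      mul_div_cancel₀ _ hfp]
    exact (le_abs_self _).trans (hMb p.2 hp)
  refine ⟨2 * M * (Real.exp (2 * (Real.sqrt M / f σ₀ * (2 * ρ))) / f σ₀ * (2 * ρ) * (2 * Real.pi)),
    fun T g hg t ht htT p hp => ?_⟩
  obtain ⟨T', g', φ, hflow, hφ, htime, hgφ⟩ := hg
  obtain ⟨s, hs, hsT, rfl⟩ := (htime t).1 ⟨ht, htT⟩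
  obtain ⟨hφs, harea⟩ := hφ s hs hsT
  have hW := hflow.isConformalFlow hρ hf hf_pos
  have hconf := hflow.hasConformalFactor hf_pos hs hsT
  have hws := hflow.contDiffOn_logFactor_slice hs hsT
  -- Multiplying the metric by `φ s` adds the constant `k` to the logarithmic factor, which leaves
  -- all its derivatives unchanged.
  set k := 1 / 2 * Real.log (φ s) with hk
  have hexpk : Real.exp (2 * k) = φ s := by
    rw [hk, ← mul_assoc]
    norm_num
    exact Real.exp_log hφs
  have hscaled : HasConformalFactor ρ f (fun p => φ s • g' s p)
      (fun p => logFactor g' (s, p) + k) := fun q hq => by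
    simp only
    rw [hconf q hq, mul_add, Real.exp_add, hexpk]
    simp [mul_comm, mul_div_assoc]
  -- The normalised metric is prescribed only on the strip; its curvature there is determined by the
  -- conformal factor, which allows the comparison with `φ s • g' s`.
  have hnew : HasConformalFactor ρ f (g (∫ x in (0 : ℝ)..s, φ x))
      (fun p => logFactor g' (s, p) + k) := fun q hq => by
    rw [hgφ s hs hsT q hq]
    exact hscaled q hq
  have hcurv_eq : scalarCurv ρ (g (∫ x in (0 : ℝ)..s, φ x)) p
      = scalarCurv ρ (fun p => φ s • g' s p) p := by
    rw [hnew.scalarCurv_eq hρ hf hf_pos (hws.add contDiffOn_const) hp,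
      hscaled.scalarCurv_eq hρ hf hf_pos (hws.add contDiffOn_const) hp]
  rw [hcurv_eq]
  have hpd : ∀ i (q : ℝ × ℝ), q ∈ strip ρ → pd ρ i (fun p => logFactor g' (s, p) + k) q
      = pd ρ i (fun p => logFactor g' (s, p)) q := fun i q hq => by
    unfold pd
    split_ifs
    · exact deriv_add_const k
    · exact derivWithin_add_const k
  exact abs_scalarCurv_le_of_area_eq_one hρ hf hδ (fun σ hσ => hmin hσ)
    (hws.add contDiffOn_const) hscaled harea
    (fun q hq => by
      rw [hpd 0 q hq]
      exact hW.pd_angle_eq_zero hρ hf hf_pos hcr hcl (s, q) ⟨hs, hsT, hq⟩)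
    (fun q hq => by
      rw [flatLaplacian_add_const]
      exact hW.flatLaplacian_nonpos hρ hf hf_pos hcr hcl hcurv (s, q) ⟨hs, hsT, hq⟩)
    (fun q hq => by
      rw [flatLaplacian_add_const, hpd 1 q hq]
      exact hW.gradient_quantity_le hρ hf hf_pos hcr hcl hcurv hM (s, q) ⟨hs, hsT, hq⟩)
    hp

/-- The bound does not need the monotonicity of the initial curvature: the estimate for
`(DW)² - DDW` controls the curvature at every point, not only on the middle parallel. -/
theorem mainTheorem8 (ρ : ℝ) (hρ : 0 < ρ) (f : ℝ → ℝ)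
    (hf_smooth : ContDiffOn ℝ ∞ f (Set.Icc (-ρ) ρ))
    (hf_pos : ∀ σ ∈ Set.Icc (-ρ) ρ, 0 < f σ)
    (hf_symm : ∀ σ ∈ Set.Icc (-ρ) ρ, f (-σ) = f σ)
    (hR_nonneg : ∀ p ∈ CylinderRicciFlow.strip ρ,
      0 ≤ CylinderRicciFlow.scalarCurv ρ (CylinderRicciFlow.warpedMetric f) p)
    (hR_decr : CylinderRicciFlow.DecreasingFromMiddle ρ (CylinderRicciFlow.warpedMetric f)) :
    ∃ C : ℝ, ∀ (T : EReal) (g : ℝ → CylinderRicciFlow.TensorField),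
      CylinderRicciFlow.IsNormalisedRicciFlow ρ (CylinderRicciFlow.warpedMetric f) T g →
      ∀ t : ℝ, 0 ≤ t → (t : EReal) < T → ∀ p ∈ CylinderRicciFlow.strip ρ,
        |CylinderRicciFlow.scalarCurv ρ (g t) p| ≤ C :=
  CylinderRicciFlow.exists_scalarCurv_bound ρ hρ f hf_smooth hf_pos hf_symm hR_nonneg
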